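/- **Setting.** Let $i_1,i_2,\dots$ be the Grassmann generators, $i_ni_m+i_mi_n=0$. For a finite set $\alpha=\{a_1<\dots<a_t\}$ of positive integers put $i_\alpha=i_{a_1}\cdots i_{a_t}$, $i_\emptyset=1$. Formal series $f=\sum_\alpha f_\alpha i_\alpha$ with $f_\alpha\in\mathbb C$ are multiplied by the Grassmann product (each coefficient of a product is a finite sum). Let $\varphi(0)=0\le\varphi(1)\le\varphi(2)\le\cdots$ be real numbers and $c_\alpha=\exp\big(\sum_{a\in\alpha}\varphi(a)\big)$, and assume $\sum_\alpha c_\alpha^{-2d}<\infty$ for some positive integer $d$. For $p\in\mathbb Z$ let $$\mathcal H_p=\Big\{f:\ \|f\|_p^2=\sum_\alpha|f_\alpha|^2c_\alpha^{2p}<\infty\Big\},\qquad \mathfrak S_1=\bigcap_p\mathcal H_p,\qquad \mathfrak S_{-1}=\bigcup_p\mathcal H_{-p}.$$ $\mathfrak S_1$ carries the topology given by all the norms $\|\cdot\|_p$, and $\mathfrak S_{-1}$, identified with the dual of $\mathfrak S_1$ by $(f,g)\mapsto\sum_\alpha f_\alpha g_\alpha$, carries the strong topology (uniform convergence on bounded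 subsets of $\mathfrak S_1$). For $f\in\mathfrak S_{-1}$ let $T_f=M_f+M_f^*:\mathfrak S_1\to\mathfrak S_{-1}$, where $M_fg=fg$ and $M_f^*$ is the adjoint of $M_f$ for the inner product $\sum_\alpha z_\alpha\overline{w_\alpha}$. Let $m:\mathbb R\to[0,\infty)$ be measurable with $\int_{\mathbb R}\frac{m(u)}{u^2+1}\,du<\infty$, and suppose that $m(u)\le K|u|^{-\beta}$ for $0<|u|\le1$ and $m(u)\le K|u|^{2N}$ for $|u|>1$, where $K>0$, $\beta<2$ and $N\in\mathbb N_0$. Let $S_m$ be the operator defined by $\widehat{S_mf}=\sqrt m\,\widehat f$, with $\widehat f(u)=\frac1{\sqrt{2\pi}}\int_{\mathbb R} e^{-iux}f(x)\,dx$, let $(\xi_n)_{n\ge1}$ be the orthonormal basis of Hermite functions of $L^2(\mathbb R)$ ($\xi_n$ of degree $n-1$), and let $$f_m(t)=\sum_{n\ge1}\Big(\int_0^t(S_m\xi_n)(u)\,du\Big)i_n,\qquad X_m(t)=T_{f_m(t)}.$$ **Theorem.** For every $t\in\mathbb R$ the operator $X_m(t)$ maps $\mathfrak S_1$ continuously to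 $\mathfrak S_{-1}$, and there are continuous linear operators $W_m(t):\mathfrak S_1\to\mathfrak S_{-1}$ with $\frac{d}{dt}X_m(t)g=W_m(t)g$ in the strong topology of $\mathfrak S_{-1}$ for all $t\in\mathbb R$ and $g\in\mathfrak S_1$. Let $a\le b$, let $Y:[a,b]\to\mathfrak S_{-1}$ be continuous for the strong topology, and let $g\in\mathfrak S_1$. Then there is a positive integer $p$ (which depends on $g$) such that $Y(t)W_m(t)g\in\mathcal H_{-p}$ for all $t\in[a,b]$ and the Pettis integral $$\int_a^bY(t)\,W_m(t)g\,dt$$ exists in $\mathfrak S_{-1}$, belongs to $\mathcal H_{-p}$, and is the limit, in the norm of $\mathcal H_{-p}$, of the Riemann sums $\sum_j(t_{j+1}-t_j)\,Y(\tau_j)W_m(\tau_j)g$ over tagged partitions $a=t_0\le\tau_0\le t_1\le\dots\le t_n=b$, as their mesh tends to $0$. -/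

import Mathlib

open Filter Topology MeasureTheory

open scoped FourierTransform ENNReal

noncomputable section

namespace Grassmann

/-- Formal series `f = ∑ f_α i_α` in the Grassmann generators `i_1, i_2, …`. A finite set
`α = {a_1 < ⋯ < a_t}` of positive integers stands for the monomial `i_α = i_{a_1} ⋯ i_{a_t}`, and the
empty set for the unit `i_0 = 1`. -/
def Series : Type := Finset ℕ+ → ℂ

instance : AddCommGroup Series := inferInstanceAs (AddCommGroup (Finset ℕ+ → ℂ))

instance : Module ℂ Series := inferInstanceAs (Module ℂ (Finset ℕ+ → ℂ))

/-- The number of transpositions needed to sort the concatenation of `α` and `β`. -/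
def inversions (α β : Finset ℕ+) : ℕ := ((α ×ˢ β).filter fun x => x.2 < x.1).card

/-- The Grassmann product: `i_α i_β = (-1)^σ(α,β) i_{α ∪ β}` if `α` and `β` are disjoint, and
`i_α i_β = 0` otherwise. The coefficient of `i_γ` in a product of series is a finite sum, over the
decompositions of `γ` into disjoint sets `α` and `β = γ \ α`. -/
instance : Mul Series where
  mul f g := fun γ => ∑ α ∈ γ.powerset, (-1) ^ inversions α (γ \ α) * f α * g (γ \ α)

/-- The monomial `i_α`. -/
def monomial (α : Finset ℕ+) : Series := fun β => if β = α then 1 else 0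

/-- The adjoint of left multiplication by `f` for the inner product `⟨z, w⟩ = ∑ z_α conj w_α`:
the coefficient of `M_f^* g` at `i_γ` is `⟨M_f^* g, i_γ⟩ = ⟨g, f i_γ⟩`. -/
def leftMulAdjoint (f g : Series) : Series :=
  fun γ => ∑' β, g β * starRingEnd ℂ ((f * monomial γ) β)

/-- The operator `T_f = M_f + M_f^*`, with `M_f g = f g`. -/
def opT (f g : Series) : Series := f * g + leftMulAdjoint f g

/-! ### The spaces `H_p`, `S_1` and `S_{-1}` -/

/-- The weights `c_α = exp (∑_{a ∈ α} φ a)`, given by a monotonically increasing sequence `φ` with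
`φ 0 = 0` such that `∑ c_α ^ (-2 d) < ∞` for some positive integer `d`. They satisfy
`c_{α ∪ β} = c_α c_β` for disjoint `α` and `β`. -/
structure Weight where
  φ : ℕ → ℝ
  mono : Monotone φ
  zero : φ 0 = 0
  summable : ∃ d : ℕ, 0 < d ∧
    Summable fun α : Finset ℕ+ => Real.exp (∑ a ∈ α, φ a) ^ (-2 * (d : ℤ))

/-- The weight `c_α`. -/
def Weight.c (w : Weight) (α : Finset ℕ+) : ℝ := Real.exp (∑ a ∈ α, w.φ a)

theorem Weight.c_pos (w : Weight) (α : Finset ℕ+) : 0 < w.c α := Real.exp_pos _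

theorem Weight.one_le_c (w : Weight) (α : Finset ℕ+) : 1 ≤ w.c α :=
  Real.one_le_exp (Finset.sum_nonneg fun a _ => w.zero ▸ w.mono (Nat.zero_le a))

/-- Multiplication of the coefficients by `c_α ^ p`. -/
def weighted (w : Weight) (p : ℤ) : Series →ₗ[ℂ] PreLp (fun _ : Finset ℕ+ => ℂ) where
  toFun f := fun α => ((w.c α ^ p : ℝ) : ℂ) * f α
  map_add' f g := by
    funext α
    exact mul_add _ _ _
  map_smul' r f := by
    funext α
    exact mul_left_comm _ _ _

/-- The space `H_p` of the series `f` with `∑ |f_α|² c_α ^ (2 p) < ∞`, for `p ∈ ℤ`. -/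
def H (w : Weight) (p : ℤ) : Submodule ℂ Series :=
  (lpSubmodule ℂ (fun _ : Finset ℕ+ => ℂ) 2).comap (weighted w p)

/-- The map `f ↦ (c_α ^ p f_α)` from `H_p` to `ℓ²`. -/
def H.toL2 (w : Weight) (p : ℤ) : H w p →ₗ[ℂ] lp (fun _ : Finset ℕ+ => ℂ) 2 where
  toFun f := ⟨weighted w p f.1, f.2⟩
  map_add' f g := Subtype.ext (map_add (weighted w p) f.1 g.1)
  map_smul' r f := Subtype.ext (map_smul (weighted w p) r f.1)

theorem H.toL2_injective (w : Weight) (p : ℤ) : Function.Injective (H.toL2 w p) := by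
  intro f g h
  apply Subtype.ext
  funext α
  have h1 : ((w.c α ^ p : ℝ) : ℂ) * f.1 α = ((w.c α ^ p : ℝ) : ℂ) * g.1 α :=
    congrFun (congrArg Subtype.val h) α
  exact mul_left_cancel₀ (Complex.ofReal_ne_zero.2 (zpow_pos (w.c_pos α) p).ne') h1

/-- The norm of `H_p` is `‖f‖_p = (∑ |f_α|² c_α ^ (2 p)) ^ (1/2)`. -/
instance (w : Weight) (p : ℤ) : NormedAddCommGroup (H w p) :=
  NormedAddCommGroup.induced _ _ (H.toL2 w p) (H.toL2_injective w p)

instance (w : Weight) (p : ℤ) : NormedSpace ℂ (H w p) :=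
  NormedSpace.induced ℂ _ _ (H.toL2 w p)

theorem H.mono (w : Weight) {p q : ℤ} (hpq : p ≤ q) : H w q ≤ H w p := by
  intro f hf
  have hf' : Memℓp (weighted w q f) 2 := hf
  refine Memℓp.mono' hf' fun α => ?_
  show ‖((w.c α ^ p : ℝ) : ℂ) * f α‖ ≤ ‖((w.c α ^ q : ℝ) : ℂ) * f α‖
  rw [norm_mul, norm_mul, Complex.norm_real, Complex.norm_real,
    Real.norm_of_nonneg (zpow_pos (w.c_pos α) p).le,
    Real.norm_of_nonneg (zpow_pos (w.c_pos α) q).le]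
  exact mul_le_mul_of_nonneg_right (zpow_le_zpow_right₀ (w.one_le_c α) hpq) (norm_nonneg _)

/-- The space of test functions `S_1 = ⋂ H_p`. -/
def S1 (w : Weight) : Submodule ℂ Series := ⨅ p : ℤ, H w p

/-- The inclusion of `S_1` in `H_p`. -/
def S1.toH {w : Weight} (p : ℤ) : S1 w →ₗ[ℂ] H w p :=
  Submodule.inclusion (iInf_le (H w) p)

/-- The Fréchet topology of `S_1`, given by all the norms `‖·‖_p`. -/
instance (w : Weight) : TopologicalSpace (S1 w) :=
  ⨅ p : ℤ, TopologicalSpace.induced (S1.toH p) inferInstance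

/-- The space of distributions `S_{-1} = ⋃ H_{-p}`. -/
def Sm1 (w : Weight) : Submodule ℂ Series where
  carrier := {f | ∃ p : ℤ, f ∈ H w (-p)}
  zero_mem' := ⟨0, Submodule.zero_mem _⟩
  add_mem' := by
    rintro f g ⟨p, hf⟩ ⟨q, hg⟩
    exact ⟨max p q, Submodule.add_mem _ (H.mono w (neg_le_neg (le_max_left p q)) hf)
      (H.mono w (neg_le_neg (le_max_right p q)) hg)⟩
  smul_mem' := by
    rintro r f ⟨p, hf⟩
    exact ⟨p, Submodule.smul_mem _ r hf⟩

/-- The inclusion of `H_{-p}` in `S_{-1}`. -/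
def H.toSm1 {w : Weight} {p : ℤ} (f : H w (-p)) : Sm1 w := ⟨f.1, p, f.2⟩

theorem pairing_bound (w : Weight) (p : ℤ) (f : H w (-p)) (g : H w p) :
    Summable (fun α => f.1 α * g.1 α) ∧ ‖∑' α, f.1 α * g.1 α‖ ≤ ‖f‖ * ‖g‖ := by
  have e : ∀ α, ‖f.1 α * g.1 α‖ = ‖H.toL2 w (-p) f α‖ * ‖H.toL2 w p g α‖ := by
    intro α
    have h0 := (zpow_pos (w.c_pos α) p).ne'
    show _ = ‖((w.c α ^ (-p) : ℝ) : ℂ) * f.1 α‖ * ‖((w.c α ^ p : ℝ) : ℂ) * g.1 α‖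
    rw [← norm_mul, zpow_neg]
    congr 1
    push_cast
    have h1 : ((w.c α : ℂ)) ^ p ≠ 0 := by exact_mod_cast h0
    field_simp
  have hs : ∀ (x : lp (fun _ : Finset ℕ+ => ℂ) 2), HasSum (fun α => ‖x α‖ ^ (2 : ℝ)) (‖x‖ ^ (2 : ℝ)) := by
    intro x
    simpa using lp.hasSum_norm (p := 2) (by norm_num) x
  obtain ⟨C, -, hC, hsum⟩ := Real.inner_le_Lp_mul_Lq_hasSum_of_nonneg
    Real.HolderConjugate.two_two (norm_nonneg (H.toL2 w (-p) f)) (norm_nonneg (H.toL2 w p g))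
    (fun α => norm_nonneg _) (fun α => norm_nonneg _) (hs _) (hs _)
  have hsum' : HasSum (fun α => ‖f.1 α * g.1 α‖) C := by
    simpa only [e] using hsum
  refine ⟨hsum'.summable.of_norm, ?_⟩
  calc ‖∑' α, f.1 α * g.1 α‖ ≤ ∑' α, ‖f.1 α * g.1 α‖ := norm_tsum_le_tsum_norm hsum'.summable
    _ = C := hsum'.tsum_eq
    _ ≤ _ := hC

theorem pairing_summable (w : Weight) (f : Sm1 w) (g : S1 w) :
    Summable fun α => f.1 α * g.1 α := by
  obtain ⟨p, hp⟩ := f.2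
  exact (pairing_bound w p ⟨f.1, hp⟩ (S1.toH p g)).1

/-- The duality `f ↦ (g ↦ ∑ f_α g_α)` between `S_{-1}` and `S_1`. -/
def pairing (w : Weight) : Sm1 w →ₗ[ℂ] (S1 w →L[ℂ] ℂ) where
  toFun f :=
    { toFun := fun g => ∑' α, f.1 α * g.1 α
      map_add' := fun g h => by
        rw [← (pairing_summable w f g).tsum_add (pairing_summable w f h)]
        exact tsum_congr fun α => mul_add _ _ _
      map_smul' := fun r g => by
        rw [RingHom.id_apply, smul_eq_mul, ← tsum_mul_left]
        exact tsum_congr fun α => mul_left_comm _ _ _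
      cont := by
        obtain ⟨p, hp⟩ := f.2
        have h1 : Continuous (S1.toH (w := w) p) :=
          continuous_iInf_dom (i := p) continuous_induced_dom
        let l : H w p →ₗ[ℂ] ℂ :=
          { toFun := fun g => ∑' α, f.1 α * g.1 α
            map_add' := fun g h => by
              rw [← (pairing_bound w p ⟨f.1, hp⟩ g).1.tsum_add (pairing_bound w p ⟨f.1, hp⟩ h).1]
              exact tsum_congr fun α => mul_add _ _ _
            map_smul' := fun r g => by
              rw [RingHom.id_apply, smul_eq_mul, ← tsum_mul_left]
              exact tsum_congr fun α => mul_left_comm _ _ _ }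
        have h2 : Continuous l :=
          AddMonoidHomClass.continuous_of_bound l ‖(⟨f.1, hp⟩ : H w (-p))‖
            fun g => (pairing_bound w p ⟨f.1, hp⟩ g).2
        exact h2.comp h1 }
  map_add' f f' := by
    ext g
    show ∑' α, (f + f').1 α * g.1 α = ∑' α, f.1 α * g.1 α + ∑' α, f'.1 α * g.1 α
    rw [← (pairing_summable w f g).tsum_add (pairing_summable w f' g)]
    exact tsum_congr fun α => add_mul _ _ _
  map_smul' r f := by
    ext g
    show ∑' α, (r • f).1 α * g.1 α = r * ∑' α, f.1 α * g.1 α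
    rw [← tsum_mul_left]
    exact tsum_congr fun α => mul_assoc _ _ _

/-- The strong topology of `S_{-1}`, the topology of uniform convergence on the bounded subsets of
`S_1`; this is the topology that Mathlib gives to the space of continuous linear functionals. -/
instance (w : Weight) : TopologicalSpace (Sm1 w) :=
  TopologicalSpace.induced (pairing w) inferInstance

/-! ### The processes `X_m` and `W_m` -/

/-- The `n`-th normalized Hermite function, `n = 1, 2, …`, an orthonormal basis of `L²(ℝ)`:
`ξ_n(x) = (√π (n-1)!)^(-1/2) He_{n-1}(√2 x) exp (-x²/2)`, with `He_k` the (probabilists') Hermite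
polynomials. -/
def hermiteFun (n : ℕ+) (x : ℝ) : ℂ :=
  (((√(√Real.pi * ((n : ℕ) - 1).factorial))⁻¹ *
    Polynomial.aeval (√2 * x) (Polynomial.hermite ((n : ℕ) - 1)) * Real.exp (-x ^ 2 / 2) : ℝ) : ℂ)

/-- The operator `S_m` with `(S_m f)^(u) = √(m u) f^(u)`, where
`f^(u) = (2π)^(-1/2) ∫ exp (-iux) f(x) dx`. In Mathlib `𝓕 f v = ∫ exp (-2πivx) f(x) dx`, so the
multiplier at `v` is `√(m (2πv))`. -/
def opS (m : ℝ → ℝ) (f : ℝ → ℂ) : ℝ → ℂ :=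
  𝓕⁻ fun v : ℝ => (√(m (2 * Real.pi * v)) : ℂ) * 𝓕 f v

/-- `f_m(t) = ∑_n (∫_0^t (S_m ξ_n)(u) du) i_n`: the coefficient at `{n}` is the integral, and all the
coefficients at sets that are not singletons are zero. -/
def fm (m : ℝ → ℝ) (t : ℝ) : Series :=
  fun α => ∑ n ∈ α, if α = {n} then ∫ u in (0 : ℝ)..t, opS m (hermiteFun n) u else 0

/-- The continuous operators `W t` from `S_1` to `S_{-1}` are the derivatives `W_m(t) = dX_m(t)/dt` of
the process `X_m(t) = T_{f_m(t)}`: the operators `X_m(t)` map `S_1` to `S_{-1}` continuously, and for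
every `g ∈ S_1` the function `t ↦ X_m(t) g` has the derivative `W t g` in the strong topology of
`S_{-1}`. -/
def IsDerivativeProcess (w : Weight) (m : ℝ → ℝ) (W : ℝ → S1 w →L[ℂ] Sm1 w) : Prop :=
  ∃ X : ℝ → S1 w →L[ℂ] Sm1 w,
    (∀ t g, (X t g : Series) = opT (fm m t) (g : Series)) ∧
    ∀ t g, Tendsto (fun h : ℝ => (h : ℂ)⁻¹ • (X (t + h) g - X t g)) (𝓝[≠] 0) (𝓝 (W t g))

/-! ### Integrals -/

/-- `I` is the limit of the Riemann sums of `F` over the tagged partitions of `[a, b]`, as the mesh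
tends to zero. -/
def IsLimitOfRiemannSums {E : Type*} [NormedAddCommGroup E] [NormedSpace ℂ E]
    (F : ℝ → E) (a b : ℝ) (I : E) : Prop :=
  ∀ ε > 0, ∃ δ > 0, ∀ (n : ℕ) (x τ : ℕ → ℝ), x 0 = a → x n = b →
    (∀ i < n, x i ≤ x (i + 1) ∧ x (i + 1) - x i < δ ∧ τ i ∈ Set.Icc (x i) (x (i + 1))) →
    ‖∑ i ∈ Finset.range n, ((x (i + 1) - x i : ℝ) : ℂ) • F (τ i) - I‖ < ε

/-- `F` is Pettis integrable on `[a, b]` (it is scalarly integrable, and has a weak integral over every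
measurable subset of `[a, b]`), and its Pettis integral over `[a, b]` is `I`. -/
def HasPettisIntegral {E : Type*} [AddCommGroup E] [Module ℂ E] [TopologicalSpace E]
    (F : ℝ → E) (a b : ℝ) (I : E) : Prop :=
  (∀ L : E →L[ℂ] ℂ, IntegrableOn (fun t => L (F t)) (Set.Icc a b)) ∧
  (∀ A : Set ℝ, MeasurableSet A → A ⊆ Set.Icc a b →
    ∃ J : E, ∀ L : E →L[ℂ] ℂ, L J = ∫ t in A, L (F t)) ∧
  ∀ L : E →L[ℂ] ℂ, L I = ∫ t in Set.Icc a b, L (F t)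

end Grassmann

end

noncomputable section

namespace Grassmann

/-! ### Hermite functions -/

/-! The proof reduces everything to coefficientwise growth bounds `|f_α| ≤ M c_α ^ p` (`HasGrowth`).
Since `∑ c_α ^ (-2d) < ∞`, such a bound puts `f` in `H_{-(p+d)}`, and coefficientwise convergence
under a common growth bound is norm convergence, by dominated convergence (`tendsto_H_of_growth`).
Growth bounds are stable under the Grassmann product and under `T_f` on test functions
(`HasGrowth.mul`, `HasGrowth.opT`).

The noise is `W_m(t) = T_w` with `w = ∑ (S_m ξ_n)(t) i_n`. A Hermite function satisfies `ξ'' = (x² -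
(2k+1)) ξ`, and moment bounds control the `L¹` norm of `(1 + x²) ξ`; hence its Fourier transform is
`O(n⁴ / (u² + 1))`. As `√m ≤ 1 + m`, the function `√m / (u² + 1)` is integrable, so `S_m ξ_n` is
continuous and `O(n⁴)` uniformly in `t`. Summability and monotonicity of the weights make `n` at
most a constant times `c_{n} ^ (2d)`, so `w` has growth uniform in `t`. The difference quotients of
`f_m` obey the same bound, and `X_m` is differentiable.

A strongly continuous `Y` on a compact interval has uniform growth
(`Sm1.exists_growth_of_isCompact`). Thus `Y(t) W_m(t) g` is a continuous curve in one Hilbert space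
`H_{-p}`. Its Riemann sums converge in norm, and continuous functionals commute with its integral.
-/

open Polynomial in
theorem derivative_hermite_succ (k : ℕ) :
    derivative (hermite (k + 1)) = (k + 1 : ℤ[X]) * hermite k := by
  induction k with
  | zero => simp
  | succ k ih =>
    rw [hermite_succ (k + 1), derivative_sub, derivative_mul, ih, derivative_X, derivative_mul,
      hermite_succ k]
    have : derivative (k + 1 : ℤ[X]) = 0 := by
      simp
    rw [this]
    push_cast
    ring

/-- The Hermite polynomial in the variable `√2 x`. -/
def scaledHermite (k : ℕ) : Polynomial ℝ :=
  ((Polynomial.hermite k).map (Int.castRingHom ℝ)).comp (Polynomial.C √2 * Polynomial.X)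

theorem eval_scaledHermite (k : ℕ) (x : ℝ) :
    (scaledHermite k).eval x = Polynomial.aeval (√2 * x) (Polynomial.hermite k) := by
  simp [scaledHermite, Polynomial.eval_comp, Polynomial.aeval_def, Polynomial.eval_map]

open Polynomial in
theorem derivative_scaledHermite_succ (k : ℕ) :
    derivative (scaledHermite (k + 1)) = C (√2 * (k + 1)) * scaledHermite k := by
  rw [scaledHermite, derivative_comp, derivative_map, derivative_hermite_succ, scaledHermite]
  simp
  ring

-- The recursion `He_{k+1} = X He_k - He_k'` after the substitution `√2 x`. The right side is
-- `-exp(x²)` times the derivative of `exp(-x²) H_k`, which is what integration by parts needs.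
open Polynomial in
theorem scaledHermite_succ (k : ℕ) :
    C √2 * scaledHermite (k + 1) = C 2 * X * scaledHermite k - derivative (scaledHermite k) := by
  have h2 : (C √2 * C √2 : ℝ[X]) = C 2 := by
    rw [← C_mul, Real.mul_self_sqrt (by norm_num)]
  rw [scaledHermite, scaledHermite, derivative_comp, derivative_map, hermite_succ]
  simp only [Polynomial.map_sub, Polynomial.map_mul, map_X, sub_comp, mul_comp, X_comp,
    derivative_mul, derivative_C, derivative_X]
  linear_combination (X * (Polynomial.map (Int.castRingHom ℝ) (hermite k)).comp (C √2 * X)) * h2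

theorem scaledHermite_zero : scaledHermite 0 = 1 := by simp [scaledHermite]

-- Differentiating the recursion and replacing the derivative of degree `k + 1` by its multiple of
-- degree `k` gives Hermite's equation.
open Polynomial in
theorem scaledHermite_ode (k : ℕ) :
    derivative (derivative (scaledHermite k)) =
      C 2 * X * derivative (scaledHermite k) - C (2 * k : ℝ) * scaledHermite k := by
  have h2 : (C √2 * C √2 : ℝ[X]) = C 2 := by
    rw [← C_mul, Real.mul_self_sqrt (by norm_num)]
  have h := congrArg derivative (scaledHermite_succ k)
  simp only [derivative_sub, derivative_mul, derivative_C, derivative_X,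
    derivative_scaledHermite_succ, map_mul, map_add, map_one] at h ⊢
  linear_combination h - (C (k : ℝ) + 1) * scaledHermite k * h2

theorem two_mul_eval_scaledHermite (k : ℕ) (x : ℝ) :
    √2 * x * (scaledHermite (k + 1)).eval x =
      (scaledHermite (k + 2)).eval x + (k + 1) * (scaledHermite k).eval x := by
  have h := congrArg (Polynomial.eval x) (scaledHermite_succ (k + 1))
  rw [derivative_scaledHermite_succ] at h
  simp only [Polynomial.eval_mul, Polynomial.eval_sub, Polynomial.eval_C, Polynomial.eval_X] at h
  have h2 : √2 * √2 = 2 := Real.mul_self_sqrt (by norm_num)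
  have h3 : √2 ≠ 0 := by positivity
  apply mul_left_cancel₀ h3
  linear_combination -h + x * (scaledHermite (k + 1)).eval x * h2

/-! ### Moments of Hermite functions -/

theorem integrable_polynomial_mul_gaussian (q : Polynomial ℝ) {b : ℝ} (hb : 0 < b) :
    Integrable fun x : ℝ => q.eval x * Real.exp (-b * x ^ 2) := by
  induction q using Polynomial.induction_on' with
  | add p q hp hq => simpa [add_mul] using! hp.add hq
  | monomial n a =>
    have := (integrable_rpow_mul_exp_neg_mul_sq hb (s := n)
      (lt_of_lt_of_le (by norm_num) n.cast_nonneg)).const_mul a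
    simpa [mul_assoc] using this

/-- One factor `H_{k+1} exp(-x²)` is, up to `-√2`, the derivative of `H_k exp(-x²)`. Integration by
parts lowers the other factor to degree `k` and produces the factor `k + 1`. -/
theorem integral_scaledHermite_sq (k : ℕ) :
    ∫ x : ℝ, (scaledHermite k).eval x ^ 2 * Real.exp (-1 * x ^ 2) = √Real.pi * k.factorial := by
  induction k with
  | zero => simpa [scaledHermite_zero] using integral_gaussian 1
  | succ k ih =>
    have hder : ∀ x : ℝ, HasDerivAt (fun x => (scaledHermite k).eval x * Real.exp (-1 * x ^ 2))
        (-√2 * (scaledHermite (k + 1)).eval x * Real.exp (-1 * x ^ 2)) x := by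
      intro x
      have h1 : HasDerivAt (fun x : ℝ => Real.exp (-1 * x ^ 2))
          (Real.exp (-1 * x ^ 2) * (-1 * (2 * x))) x := by
        simpa using (((hasDerivAt_id x).pow 2).const_mul (-1)).exp
      refine (((scaledHermite k).hasDerivAt x).mul h1).congr_deriv ?_
      have h := congrArg (Polynomial.eval x) (scaledHermite_succ k)
      simp only [Polynomial.eval_mul, Polynomial.eval_sub, Polynomial.eval_C,
        Polynomial.eval_X] at h
      linear_combination Real.exp (-1 * x ^ 2) * h
    have hibp := integral_mul_deriv_eq_deriv_mul_of_integrable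
      (u := fun x => (scaledHermite (k + 1)).eval x)
      (v := fun x => (scaledHermite k).eval x * Real.exp (-1 * x ^ 2))
      (u' := fun x => (Polynomial.derivative (scaledHermite (k + 1))).eval x)
      (v' := fun x => -√2 * (scaledHermite (k + 1)).eval x * Real.exp (-1 * x ^ 2))
      (fun x _ => (scaledHermite (k + 1)).hasDerivAt x) (fun x _ => hder x)
      (by
        have := integrable_polynomial_mul_gaussian
          (Polynomial.C (-√2) * scaledHermite (k + 1) ^ 2) one_pos
        refine this.congr (ae_of_all _ fun x => ?_)
        simp only [Polynomial.eval_mul, Polynomial.eval_pow, Polynomial.eval_C, Pi.mul_apply]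
        ring)
      (by
        have := integrable_polynomial_mul_gaussian
          (Polynomial.derivative (scaledHermite (k + 1)) * scaledHermite k) one_pos
        refine this.congr (ae_of_all _ fun x => ?_)
        simp only [Polynomial.eval_mul, Pi.mul_apply]
        ring)
      (by
        have := integrable_polynomial_mul_gaussian
          (scaledHermite (k + 1) * scaledHermite k) one_pos
        refine this.congr (ae_of_all _ fun x => ?_)
        simp only [Polynomial.eval_mul, Pi.mul_apply]
        ring)
    rw [derivative_scaledHermite_succ] at hibp
    have e1 : ∀ x : ℝ, (scaledHermite (k + 1)).eval x *
        (-√2 * (scaledHermite (k + 1)).eval x * Real.exp (-1 * x ^ 2)) =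
        -√2 * ((scaledHermite (k + 1)).eval x ^ 2 * Real.exp (-1 * x ^ 2)) := fun x => by ring
    have e2 : ∀ x : ℝ, (Polynomial.C (√2 * (k + 1)) * scaledHermite k).eval x *
        ((scaledHermite k).eval x * Real.exp (-1 * x ^ 2)) =
        √2 * (k + 1) * ((scaledHermite k).eval x ^ 2 * Real.exp (-1 * x ^ 2)) := fun x => by
      simp; ring
    simp only [e1, e2] at hibp
    rw [integral_const_mul, integral_const_mul, ih] at hibp
    have h3 : √2 ≠ 0 := by positivity
    apply mul_left_cancel₀ h3
    rw [Nat.factorial_succ]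
    push_cast
    linear_combination -hibp

theorem integrable_pow_mul_scaledHermite_sq (j k : ℕ) :
    Integrable fun x : ℝ => x ^ (2 * j) * (scaledHermite k).eval x ^ 2 * Real.exp (-1 * x ^ 2) := by
  have := integrable_polynomial_mul_gaussian
    (Polynomial.X ^ (2 * j) * scaledHermite k ^ 2) one_pos
  simpa using this

/-- Induction on `j`: the three-term recurrence trades a factor `x²` for the neighbouring degrees `k
± 1`. Degree `0` has no lower neighbour and is treated separately through `H_1 = √2 x`. -/
theorem integral_pow_mul_scaledHermite_sq_le (j k : ℕ) :
    ∫ x : ℝ, x ^ (2 * j) * (scaledHermite k).eval x ^ 2 * Real.exp (-1 * x ^ 2) ≤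
      √Real.pi * k.factorial * (2 * (k + j)) ^ j := by
  induction j generalizing k with
  | zero => simpa using (integral_scaledHermite_sq k).le
  | succ j ih =>
    have hs : √2 * √2 = 2 := Real.mul_self_sqrt (by norm_num)
    rcases k with _ | k
    · have h1 : ∫ x : ℝ, x ^ (2 * (j + 1)) * (scaledHermite 0).eval x ^ 2 * Real.exp (-1 * x ^ 2) ≤
          ∫ x : ℝ, x ^ (2 * j) * (scaledHermite 1).eval x ^ 2 * Real.exp (-1 * x ^ 2) := by
        refine integral_mono (integrable_pow_mul_scaledHermite_sq _ _)
          (integrable_pow_mul_scaledHermite_sq _ _) fun x => ?_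
        have : (scaledHermite 1).eval x = √2 * x := by
          rw [eval_scaledHermite, Polynomial.hermite_one]; simp
        simp only [this, scaledHermite_zero, Polynomial.eval_one]
        have h0 : 0 ≤ x ^ (2 * j) * x ^ 2 * Real.exp (-1 * x ^ 2) := by
          rw [pow_mul]; positivity
        have : x ^ (2 * j) * (√2 * x) ^ 2 * Real.exp (-1 * x ^ 2) =
          2 * (x ^ (2 * j) * x ^ 2 * Real.exp (-1 * x ^ 2)) := by
          linear_combination x ^ (2 * j) * x ^ 2 * Real.exp (-1 * x ^ 2) * hs
        have e : x ^ (2 * (j + 1)) = x ^ (2 * j) * x ^ 2 := by ring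
        rw [this, e, one_pow, mul_one]
        linarith
      refine h1.trans ((ih 1).trans ?_)
      have : (2 * ((1 : ℕ) + (j : ℝ))) ^ j ≤ (2 * ((0 : ℕ) + ((j + 1 : ℕ) : ℝ))) ^ (j + 1) := by
        push_cast
        rw [zero_add, add_comm (1 : ℝ)]
        exact pow_le_pow_right₀ (by linarith [(j.cast_nonneg : (0 : ℝ) ≤ j)]) (Nat.le_succ j)
      simpa using mul_le_mul_of_nonneg_left this (Real.sqrt_nonneg Real.pi)
    · have h1 : ∫ x : ℝ, x ^ (2 * (j + 1)) * (scaledHermite (k + 1)).eval x ^ 2 *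
            Real.exp (-1 * x ^ 2) ≤
          ∫ x : ℝ, (x ^ (2 * j) * (scaledHermite (k + 2)).eval x ^ 2 * Real.exp (-1 * x ^ 2) +
            (k + 1) ^ 2 *
              (x ^ (2 * j) * (scaledHermite k).eval x ^ 2 * Real.exp (-1 * x ^ 2))) := by
        refine integral_mono (integrable_pow_mul_scaledHermite_sq _ _)
          ((integrable_pow_mul_scaledHermite_sq _ _).add
            ((integrable_pow_mul_scaledHermite_sq _ _).const_mul _)) fun x => ?_
        have h := two_mul_eval_scaledHermite k x
        set A := (scaledHermite (k + 2)).eval x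
        set B := (scaledHermite (k + 1)).eval x
        set D := (scaledHermite k).eval x
        have h0 : 0 ≤ x ^ (2 * j) * Real.exp (-1 * x ^ 2) := by
          rw [pow_mul]; positivity
        have h4 : x ^ 2 * B ^ 2 ≤ A ^ 2 + (k + 1) ^ 2 * D ^ 2 := by
          have : 2 * (x ^ 2 * B ^ 2) = (A + (k + 1) * D) ^ 2 := by
            rw [← h]; linear_combination -x ^ 2 * B ^ 2 * hs
          nlinarith [sq_nonneg (A - (k + 1) * D)]
        have := mul_le_mul_of_nonneg_left h4 h0
        have e : x ^ (2 * (j + 1)) = x ^ (2 * j) * x ^ 2 := by ring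
        simp only [e]
        linarith
      rw [integral_add (integrable_pow_mul_scaledHermite_sq _ _)
        ((integrable_pow_mul_scaledHermite_sq _ _).const_mul _), integral_const_mul] at h1
      have i1 := ih (k + 2)
      have i2 := mul_le_mul_of_nonneg_left (ih k) (sq_nonneg ((k : ℝ) + 1))
      refine h1.trans ((add_le_add i1 i2).trans ?_)
      have hp : (0 : ℝ) ≤ √Real.pi := Real.sqrt_nonneg _
      have hb : (2 * ((k : ℝ) + j)) ^ j ≤ (2 * ((k : ℝ) + 2 + j)) ^ j := by gcongr; linarith
      rw [Nat.factorial_succ (k + 1), Nat.factorial_succ k]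
      push_cast
      have e : 2 * ((k : ℝ) + 1 + (j + 1)) = 2 * (k + 2 + j) := by ring
      rw [e, pow_succ (2 * ((k : ℝ) + 2 + j)) j]
      set Z := (2 * ((k : ℝ) + 2 + j)) ^ j
      have hZ : 0 ≤ Z := by positivity
      have hf : (0 : ℝ) ≤ √Real.pi * ((k + 1) * k.factorial) := by positivity
      have hc : (0 : ℝ) ≤ (k + 1) ^ 2 * (√Real.pi * k.factorial) := by positivity
      have h5 := mul_le_mul_of_nonneg_left hb hc
      -- The two neighbours contribute `(k+2) + (k+1) = 2k + 3` times the common factor, against the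
      -- available `2(k + 2 + j)`; the slack is `1 + 2j`.
      have h6 : √Real.pi * ((k + 1) * k.factorial) * (Z * (2 * (k + 2 + j))) -
          (√Real.pi * ((k + 1 + 1) * ((k + 1) * k.factorial)) * Z +
            (k + 1) ^ 2 * (√Real.pi * k.factorial) * Z) =
          √Real.pi * ((k + 1) * k.factorial) * Z * (1 + 2 * j) := by ring
      have h7 : 0 ≤ √Real.pi * ((k + 1) * k.factorial) * Z * (1 + 2 * (j : ℝ)) := by positivity
      linarith

/-! ### Fourier transforms of Hermite functions -/

/-- The product of a polynomial and `exp (-x²/2)`. -/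
def gaussianPoly (q : Polynomial ℝ) (x : ℝ) : ℂ := ((q.eval x * Real.exp (-x ^ 2 / 2) : ℝ) : ℂ)

theorem integrable_gaussianPoly (q : Polynomial ℝ) : Integrable (gaussianPoly q) := by
  have := (integrable_polynomial_mul_gaussian q (b := 1 / 2) (by norm_num)).ofReal (𝕜 := ℂ)
  refine this.congr (ae_of_all _ fun x => ?_)
  have e : -(1 / 2) * x ^ 2 = -x ^ 2 / 2 := by ring
  simp only [gaussianPoly, e]
  rfl

theorem hasDerivAt_gaussianPoly (q : Polynomial ℝ) (x : ℝ) :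
    HasDerivAt (gaussianPoly q)
      (gaussianPoly (Polynomial.derivative q - Polynomial.X * q) x) x := by
  have h1 : HasDerivAt (fun x : ℝ => Real.exp (-x ^ 2 / 2))
      (Real.exp (-x ^ 2 / 2) * (-(2 * x) / 2)) x := by
    simpa using (((hasDerivAt_id x).pow 2).neg.div_const 2).exp
  refine ((q.hasDerivAt x).mul h1).ofReal_comp.congr_deriv ?_
  simp only [gaussianPoly, Polynomial.eval_sub, Polynomial.eval_mul, Polynomial.eval_X]
  congr 1
  ring

theorem deriv_gaussianPoly (q : Polynomial ℝ) :
    deriv (gaussianPoly q) = gaussianPoly (Polynomial.derivative q - Polynomial.X * q) :=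
  funext fun x => (hasDerivAt_gaussianPoly q x).deriv

theorem fourier_deriv_gaussianPoly (q : Polynomial ℝ) (v : ℝ) :
    𝓕 (gaussianPoly (Polynomial.derivative q - Polynomial.X * q)) v =
      (2 * Real.pi * Complex.I * v) * 𝓕 (gaussianPoly q) v := by
  rw [← deriv_gaussianPoly, Real.fourier_deriv (integrable_gaussianPoly q)
    (fun x => (hasDerivAt_gaussianPoly q x).differentiableAt)
    (by rw [deriv_gaussianPoly]; exact integrable_gaussianPoly _)]
  simp

theorem norm_fourier_le_integral_norm (f : ℝ → ℂ) (v : ℝ) : ‖𝓕 f v‖ ≤ ∫ x, ‖f x‖ := by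
  rw [Real.fourier_real_eq]
  refine (norm_integral_le_integral_norm _).trans (le_of_eq ?_)
  simp

/-- The polynomial factor of the normalized Hermite function of degree `k`. -/
def normalizedHermite (k : ℕ) : Polynomial ℝ :=
  Polynomial.C (√(√Real.pi * k.factorial))⁻¹ * scaledHermite k

theorem hermiteFun_eq (n : ℕ+) : hermiteFun n = gaussianPoly (normalizedHermite ((n : ℕ) - 1)) := by
  funext x
  simp [hermiteFun, gaussianPoly, normalizedHermite, eval_scaledHermite]

/-- Hermite's equation makes the Hermite functions eigenfunctions of the harmonic oscillator. The
polynomial on the left is `q ↦ q' - X q` applied twice, that is, the second derivative. -/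
theorem gaussianPoly_second_deriv (k : ℕ) (x : ℝ) :
    gaussianPoly (Polynomial.derivative
      (Polynomial.derivative (normalizedHermite k) - Polynomial.X * normalizedHermite k) -
        Polynomial.X *
          (Polynomial.derivative (normalizedHermite k) - Polynomial.X * normalizedHermite k)) x =
      ((x ^ 2 - (2 * k + 1) : ℝ) : ℂ) * gaussianPoly (normalizedHermite k) x := by
  have h := congrArg (Polynomial.eval x) (scaledHermite_ode k)
  rw [gaussianPoly, gaussianPoly, ← Complex.ofReal_mul]
  congr 1
  simp only [normalizedHermite, Polynomial.derivative_mul, Polynomial.derivative_C,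
    Polynomial.derivative_X, Polynomial.derivative_sub, Polynomial.eval_mul, Polynomial.eval_sub,
    zero_mul, zero_add,
    Polynomial.eval_add, Polynomial.eval_C, Polynomial.eval_X, Polynomial.eval_one] at h ⊢
  linear_combination (√(√Real.pi * k.factorial))⁻¹ * Real.exp (-x ^ 2 / 2) * h

theorem integrable_sq_gaussianPoly (k : ℕ) :
    Integrable fun x : ℝ => (1 + x ^ 2) * ‖gaussianPoly (normalizedHermite k) x‖ := by
  have := (integrable_gaussianPoly ((1 + Polynomial.X ^ 2) * normalizedHermite k)).norm
  refine this.congr (ae_of_all _ fun x => ?_)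
  have h : (0 : ℝ) ≤ 1 + x ^ 2 := by positivity
  simp only [gaussianPoly, Polynomial.eval_mul, Complex.norm_real, norm_mul, Polynomial.eval_add,
    Polynomial.eval_one, Polynomial.eval_pow, Polynomial.eval_X]
  rw [Real.norm_of_nonneg h, mul_assoc]

theorem norm_gaussianPoly_normalizedHermite_sq (k : ℕ) (x : ℝ) :
    ‖gaussianPoly (normalizedHermite k) x‖ ^ 2 =
      (√Real.pi * k.factorial)⁻¹ *
        ((scaledHermite k).eval x ^ 2 * Real.exp (-1 * x ^ 2)) := by
  have h : (0 : ℝ) ≤ √Real.pi * k.factorial := by positivity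
  have e : -1 * x ^ 2 = -x ^ 2 / 2 + -x ^ 2 / 2 := by ring
  rw [gaussianPoly, Complex.norm_real, Real.norm_eq_abs, sq_abs, normalizedHermite,
    Polynomial.eval_mul, Polynomial.eval_C, e, Real.exp_add, mul_pow, mul_pow, inv_pow,
    Real.sq_sqrt h]
  ring

/-- A pointwise inequality reduces the `L¹` norm to the moments `j = 0` and `j = 3` of the square.
The constant is `872 = 4 + 4 + 4 · 216`, from `π < 4` and `(2(k+3))³ ≤ 216 (k+1)³`. -/
theorem integral_sq_gaussianPoly_le (k : ℕ) :
    ∫ x : ℝ, (1 + x ^ 2) * ‖gaussianPoly (normalizedHermite k) x‖ ≤ 872 * ((k : ℝ) + 1) ^ 3 := by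
  have i0 := integrable_pow_mul_scaledHermite_sq 0 k
  have i3 := integrable_pow_mul_scaledHermite_sq 3 k
  have hpos : 0 < √Real.pi * k.factorial := by
    have := Real.sqrt_pos.2 Real.pi_pos
    positivity
  have hmono : ∫ x : ℝ, (1 + x ^ 2) * ‖gaussianPoly (normalizedHermite k) x‖ ≤
      ∫ x : ℝ, ((1 + x ^ 2)⁻¹ + 4 * (√Real.pi * k.factorial)⁻¹ *
        (x ^ (2 * 0) * (scaledHermite k).eval x ^ 2 * Real.exp (-1 * x ^ 2) +
          x ^ (2 * 3) * (scaledHermite k).eval x ^ 2 * Real.exp (-1 * x ^ 2))) := by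
    refine integral_mono (integrable_sq_gaussianPoly k)
      (integrable_inv_one_add_sq.add ((i0.add i3).const_mul _)) fun x => ?_
    have hs : 0 < 1 + x ^ 2 := by positivity
    have h := norm_gaussianPoly_normalizedHermite_sq k x
    set u := ‖gaussianPoly (normalizedHermite k) x‖
    have hu : 0 ≤ u := norm_nonneg _
    have e : 4 * (√Real.pi * k.factorial)⁻¹ *
        (x ^ (2 * 0) * (scaledHermite k).eval x ^ 2 * Real.exp (-1 * x ^ 2) +
          x ^ (2 * 3) * (scaledHermite k).eval x ^ 2 * Real.exp (-1 * x ^ 2)) =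
        4 * (1 + x ^ 6) * u ^ 2 := by
      rw [h]; ring
    simp only [e]
    have h1 : (1 + x ^ 2) ^ 3 ≤ 4 * (1 + x ^ 6) := by
      nlinarith [mul_nonneg hs.le (sq_nonneg (x ^ 2 - 1))]
    have h2 := mul_le_mul_of_nonneg_right h1 (sq_nonneg u)
    have h3 : (1 + x ^ 2) * u ≤ (1 + x ^ 2)⁻¹ + (1 + x ^ 2) ^ 3 * u ^ 2 := by
      set s := 1 + x ^ 2
      have h4 : s⁻¹ + s ^ 3 * u ^ 2 - s * u =
          s⁻¹ * ((s ^ 2 * u - 1 / 2) ^ 2 + 3 / 4) := by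
        field_simp; ring
      have h5 : 0 ≤ s⁻¹ * ((s ^ 2 * u - 1 / 2) ^ 2 + 3 / 4) := by positivity
      linarith
    linarith
  refine hmono.trans ?_
  have hadd := integral_add integrable_inv_one_add_sq
    ((i0.add i3).const_mul (4 * (√Real.pi * k.factorial)⁻¹))
  simp only [Pi.add_apply] at hadd
  rw [hadd, integral_const_mul, integral_add i0 i3, integral_univ_inv_one_add_sq]
  have b0 := integral_pow_mul_scaledHermite_sq_le 0 k
  have b3 := integral_pow_mul_scaledHermite_sq_le 3 k
  have hc : 0 ≤ 4 * (√Real.pi * k.factorial)⁻¹ := by positivity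
  have b := mul_le_mul_of_nonneg_left (add_le_add b0 b3) hc
  have e : 4 * (√Real.pi * k.factorial)⁻¹ *
      (√Real.pi * k.factorial * (2 * (k + (0 : ℕ))) ^ 0 +
        √Real.pi * k.factorial * (2 * (k + (3 : ℕ))) ^ 3) =
      4 * (1 + (2 * ((k : ℝ) + 3)) ^ 3) := by
    push_cast
    field_simp
  rw [e] at b
  have hk : (0 : ℝ) ≤ k := k.cast_nonneg
  have hpi := Real.pi_lt_four
  have h6 : Real.pi + 4 * (1 + (2 * ((k : ℝ) + 3)) ^ 3) ≤ 872 * ((k : ℝ) + 1) ^ 3 := by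
    nlinarith [pow_nonneg hk 2, pow_nonneg hk 3]
  linarith

/-- The Fourier transforms of the Hermite functions decay quadratically, with constants that grow
polynomially in the degree. -/
theorem norm_fourier_hermiteFun_le (n : ℕ+) (v : ℝ) :
    ‖𝓕 (hermiteFun n) v‖ ≤ 2616 * (n : ℝ) ^ 4 * ((2 * Real.pi * v) ^ 2 + 1)⁻¹ := by
  rw [hermiteFun_eq]
  set k := (n : ℕ) - 1 with hk
  have hn : (n : ℝ) = k + 1 := by
    have : (n : ℕ) = k + 1 := by have := n.pos; omega
    exact_mod_cast this
  rw [hn]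
  have hk0 : (0 : ℝ) ≤ k := k.cast_nonneg
  have hI := integral_sq_gaussianPoly_le k
  have h0 : ‖𝓕 (gaussianPoly (normalizedHermite k)) v‖ ≤ 872 * ((k : ℝ) + 1) ^ 3 := by
    refine (norm_fourier_le_integral_norm _ v).trans (le_trans ?_ hI)
    refine integral_mono (integrable_gaussianPoly _).norm (integrable_sq_gaussianPoly k) fun x => ?_
    exact le_mul_of_one_le_left (norm_nonneg _) (by nlinarith [sq_nonneg x])
  have h2 : (2 * Real.pi * v) ^ 2 * ‖𝓕 (gaussianPoly (normalizedHermite k)) v‖ ≤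
      (2 * k + 1) * (872 * ((k : ℝ) + 1) ^ 3) := by
    have e : (2 * Real.pi * v) ^ 2 * ‖𝓕 (gaussianPoly (normalizedHermite k)) v‖ =
        ‖𝓕 (gaussianPoly (Polynomial.derivative
      (Polynomial.derivative (normalizedHermite k) - Polynomial.X * normalizedHermite k) -
        Polynomial.X *
          (Polynomial.derivative (normalizedHermite k) -
            Polynomial.X * normalizedHermite k))) v‖ := by
      rw [fourier_deriv_gaussianPoly, fourier_deriv_gaussianPoly, ← mul_assoc, norm_mul, norm_mul,
        ← sq_abs (2 * Real.pi * v)]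
      congr 1
      simp [abs_mul]
      ring
    rw [e]
    refine (norm_fourier_le_integral_norm _ v).trans
      (le_trans ?_ (mul_le_mul_of_nonneg_left hI (by positivity)))
    rw [← integral_const_mul]
    refine integral_mono (integrable_gaussianPoly _).norm
      ((integrable_sq_gaussianPoly k).const_mul _) fun x => ?_
    simp only [gaussianPoly_second_deriv, norm_mul, Complex.norm_real, ← mul_assoc]
    refine mul_le_mul_of_nonneg_right ?_ (norm_nonneg _)
    rw [Real.norm_eq_abs, abs_le]
    constructor <;> nlinarith [sq_nonneg x, mul_nonneg hk0 (sq_nonneg x)]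
  -- `h0` and `h2` add up to `1744 (k+1)⁴`, so `2616 = 3 · 872` leaves room.
  rw [← div_eq_mul_inv, le_div_iff₀ (by positivity)]
  nlinarith [mul_nonneg hk0 (pow_nonneg (by positivity : (0 : ℝ) ≤ k + 1) 3),
    pow_nonneg (by positivity : (0 : ℝ) ≤ (k : ℝ) + 1) 3]

/-! ### Continuity and size of `S_m ξ_n` -/

/-- The integral that bounds `S_m ξ_n`. -/
theorem integrable_sqrt_div {m : ℝ → ℝ} (hm : Measurable m) (hm0 : ∀ u, 0 ≤ m u)
    (hint : Integrable fun u => m u / (u ^ 2 + 1)) :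
    Integrable fun v : ℝ => √(m (2 * Real.pi * v)) * ((2 * Real.pi * v) ^ 2 + 1)⁻¹ := by
  have h1 : Integrable fun u : ℝ => √(m u) * (u ^ 2 + 1)⁻¹ := by
    refine ((integrable_inv_one_add_sq).add hint).mono' (by fun_prop) (ae_of_all _ fun u => ?_)
    have h0 : (0 : ℝ) ≤ (u ^ 2 + 1)⁻¹ := by positivity
    rw [Real.norm_of_nonneg (by positivity)]
    have h2 : √(m u) ≤ 1 + m u := by
      nlinarith [Real.sq_sqrt (hm0 u), sq_nonneg (√(m u) - 1), Real.sqrt_nonneg (m u)]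
    have := mul_le_mul_of_nonneg_right h2 h0
    simp only [Pi.add_apply]
    rw [add_comm (1 : ℝ) (u ^ 2), div_eq_mul_inv]
    linarith
  exact h1.comp_mul_left' (by positivity)

theorem integrable_opS_integrand {m : ℝ → ℝ} (hm : Measurable m) (hm0 : ∀ u, 0 ≤ m u)
    (hint : Integrable fun u => m u / (u ^ 2 + 1)) (n : ℕ+) :
    Integrable fun v : ℝ => (√(m (2 * Real.pi * v)) : ℂ) * 𝓕 (hermiteFun n) v := by
  have hc : Continuous (𝓕 (hermiteFun n)) := by
    rw [hermiteFun_eq]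
    exact VectorFourier.fourierIntegral_continuous Real.continuous_fourierChar
      (by exact continuous_inner) (integrable_gaussianPoly _)
  refine ((integrable_sqrt_div hm hm0 hint).const_mul (2616 * (n : ℝ) ^ 4)).mono'
    ((Complex.measurable_ofReal.comp (hm.comp (measurable_id.const_mul (2 * Real.pi))).sqrt).mul
      hc.measurable).aestronglyMeasurable (ae_of_all _ fun v => ?_)
  rw [norm_mul, Complex.norm_real, Real.norm_of_nonneg (Real.sqrt_nonneg _)]
  have := mul_le_mul_of_nonneg_left (norm_fourier_hermiteFun_le n v)
    (Real.sqrt_nonneg (m (2 * Real.pi * v)))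
  linarith

theorem continuous_opS_hermiteFun {m : ℝ → ℝ} (hm : Measurable m) (hm0 : ∀ u, 0 ≤ m u)
    (hint : Integrable fun u => m u / (u ^ 2 + 1)) (n : ℕ+) :
    Continuous (opS m (hermiteFun n)) := by
  have h := integrable_opS_integrand hm hm0 hint n
  have hc : Continuous (𝓕 fun v : ℝ => (√(m (2 * Real.pi * v)) : ℂ) * 𝓕 (hermiteFun n) v) :=
    VectorFourier.fourierIntegral_continuous Real.continuous_fourierChar
      (by exact continuous_inner) h
  have : opS m (hermiteFun n) = fun t =>
      (𝓕 fun v : ℝ => (√(m (2 * Real.pi * v)) : ℂ) * 𝓕 (hermiteFun n) v) (-t) := by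
    funext t
    rw [opS, Real.fourierInv_eq_fourier_neg]
  rw [this]
  exact hc.comp continuous_neg

/-- The inverse Fourier transform is bounded by the `L¹` norm of its integrand, whence the
uniformity in `t`. -/
theorem exists_norm_opS_hermiteFun_le {m : ℝ → ℝ} (hm : Measurable m) (hm0 : ∀ u, 0 ≤ m u)
    (hint : Integrable fun u => m u / (u ^ 2 + 1)) :
    ∃ C : ℝ, 0 ≤ C ∧ ∀ (n : ℕ+) (t : ℝ), ‖opS m (hermiteFun n) t‖ ≤ C * (n : ℝ) ^ 4 := by
  refine ⟨2616 * ∫ v : ℝ, √(m (2 * Real.pi * v)) * ((2 * Real.pi * v) ^ 2 + 1)⁻¹,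
    mul_nonneg (by norm_num) (integral_nonneg fun v => by positivity), fun n t => ?_⟩
  have h := integrable_opS_integrand hm hm0 hint n
  rw [opS, Real.fourierInv_eq_fourier_neg]
  refine (norm_fourier_le_integral_norm _ _).trans ?_
  rw [mul_right_comm, ← integral_const_mul]
  refine integral_mono h.norm ((integrable_sqrt_div hm hm0 hint).const_mul _) fun v => ?_
  simp only [norm_mul, Complex.norm_real, Real.norm_of_nonneg (Real.sqrt_nonneg _)]
  have := mul_le_mul_of_nonneg_left (norm_fourier_hermiteFun_le n v)
    (Real.sqrt_nonneg (m (2 * Real.pi * v)))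
  linarith

section Growth

/-! ### Growth of coefficients -/

/-- A positive integer `d` with `∑ c_α ^ (-2 d) < ∞`. -/
def Weight.d (w : Weight) : ℕ := w.summable.choose

theorem Weight.summable_inv_pow (w : Weight) : Summable fun α => (w.c α ^ (2 * w.d))⁻¹ := by
  refine w.summable.choose_spec.2.congr fun α => ?_
  rw [neg_mul, zpow_neg]
  norm_cast

/-- The sum of `c_α ^ (-2 d)`. -/
def Weight.total (w : Weight) : ℝ := ∑' α, (w.c α ^ (2 * w.d))⁻¹

theorem Weight.total_nonneg (w : Weight) : 0 ≤ w.total :=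
  tsum_nonneg fun α => inv_nonneg.2 (pow_nonneg (w.c_pos α).le _)

/-- The coefficients of `f` are bounded by `M c_α ^ p`. -/
def HasGrowth (w : Weight) (M : ℝ) (p : ℕ) (f : Series) : Prop :=
  ∀ α, ‖f α‖ ≤ M * w.c α ^ p

variable {w : Weight} {M : ℝ} {p : ℕ} {f : Series}

theorem HasGrowth.nonneg (h : HasGrowth w M p f) : 0 ≤ M :=
  nonneg_of_mul_nonneg_left ((norm_nonneg _).trans (h ∅)) (pow_pos (w.c_pos ∅) p)

theorem HasGrowth.mono (h : HasGrowth w M p f) {M' : ℝ} {p' : ℕ} (hM : M ≤ M') (hp : p ≤ p') :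
    HasGrowth w M' p' f := fun α =>
  (h α).trans (mul_le_mul hM (pow_le_pow_right₀ (w.one_le_c α) hp)
    (pow_nonneg (w.c_pos α).le _) (h.nonneg.trans hM))

theorem HasGrowth.norm_weighted_sq_le (h : HasGrowth w M p f) (α : Finset ℕ+) :
    ‖weighted w (-((p + w.d : ℕ) : ℤ)) f α‖ ^ (2 : ℝ) ≤ M ^ 2 * (w.c α ^ (2 * w.d))⁻¹ := by
  have hc := w.c_pos α
  have h1 : ‖weighted w (-((p + w.d : ℕ) : ℤ)) f α‖ ≤ M * (w.c α ^ w.d)⁻¹ := by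
    show ‖((w.c α ^ (-((p + w.d : ℕ) : ℤ)) : ℝ) : ℂ) * f α‖ ≤ _
    rw [norm_mul, Complex.norm_real, Real.norm_of_nonneg (zpow_pos hc _).le, zpow_neg, zpow_natCast,
      inv_mul_le_iff₀ (pow_pos hc _), pow_add]
    refine (h α).trans (le_of_eq ?_)
    field_simp
  have h2 := pow_le_pow_left₀ (norm_nonneg _) h1 2
  rw [Real.rpow_two]
  refine h2.trans (le_of_eq ?_)
  rw [mul_pow, inv_pow, ← pow_mul, mul_comm 2]

/-- Giving up `d` further powers of the weight turns a pointwise bound into square summability. -/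
theorem HasGrowth.mem (h : HasGrowth w M p f) : f ∈ H w (-((p + w.d : ℕ) : ℤ)) := by
  refine memℓp_gen ?_
  simp only [ENNReal.toReal_ofNat]
  exact Summable.of_nonneg_of_le (fun α => by positivity) h.norm_weighted_sq_le
    (w.summable_inv_pow.mul_left _)

theorem H.norm_sq_eq (q : ℤ) (F : H w q) :
    ‖F‖ ^ 2 = ∑' α, ‖weighted w q F.1 α‖ ^ (2 : ℝ) := by
  have := lp.norm_rpow_eq_tsum (p := 2) (by norm_num) (H.toL2 w q F)
  simp only [ENNReal.toReal_ofNat] at this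
  rw [← Real.rpow_two]
  exact this

theorem HasGrowth.norm_le {F : H w (-((p + w.d : ℕ) : ℤ))} (h : HasGrowth w M p F.1) :
    ‖F‖ ≤ M * √w.total := by
  have h1 : ‖F‖ ^ 2 ≤ M ^ 2 * w.total := by
    rw [H.norm_sq_eq, Weight.total, ← tsum_mul_left]
    refine Summable.tsum_le_tsum h.norm_weighted_sq_le ?_ (w.summable_inv_pow.mul_left _)
    exact Summable.of_nonneg_of_le (fun α => by positivity) h.norm_weighted_sq_le
      (w.summable_inv_pow.mul_left _)
  refine le_of_sq_le_sq ?_ (mul_nonneg h.nonneg (Real.sqrt_nonneg _))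
  rwa [mul_pow, Real.sq_sqrt w.total_nonneg]

/-- Coefficientwise convergence with a uniform bound on the growth implies convergence in norm. -/
theorem tendsto_H_of_growth {ι : Type*} {l : Filter ι} {F : ι → H w (-((p + w.d : ℕ) : ℤ))}
    {G : H w (-((p + w.d : ℕ) : ℤ))} (hF : ∀ᶠ i in l, HasGrowth w M p (F i).1)
    (hG : HasGrowth w M p G.1) (h : ∀ α, Tendsto (fun i => (F i).1 α) l (𝓝 (G.1 α))) :
    Tendsto F l (𝓝 G) := by
  rw [tendsto_iff_norm_sub_tendsto_zero]
  have h1 : Tendsto (fun i => ‖F i - G‖ ^ 2) l (𝓝 0) := by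
    simp only [H.norm_sq_eq]
    have h0 : (∑' _ : Finset ℕ+, (0 : ℝ)) = 0 := tsum_zero
    refine h0 ▸ tendsto_tsum_of_dominated_convergence (w.summable_inv_pow.mul_left ((M + M) ^ 2))
      (fun α => ?_) ?_
    · have h2 : Tendsto (fun i => ‖((w.c α ^ (-((p + w.d : ℕ) : ℤ)) : ℝ) : ℂ) *
          ((F i).1 α - G.1 α)‖ ^ (2 : ℕ)) l (𝓝 0) := by
        have := (((h α).sub_const (G.1 α)).const_mul
          ((w.c α ^ (-((p + w.d : ℕ) : ℤ)) : ℝ) : ℂ)).norm.pow 2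
        simpa using this
      refine h2.congr fun i => ?_
      rw [← Real.rpow_two]
      rfl
    · filter_upwards [hF] with i hi α
      have h3 : HasGrowth w (M + M) p (F i - G : H w (-((p + w.d : ℕ) : ℤ))).1 := fun α => by
        rw [add_mul]
        exact (norm_sub_le ((F i).1 α) (G.1 α)).trans (add_le_add (hi α) (hG α))
      rw [Real.norm_of_nonneg (by positivity)]
      exact h3.norm_weighted_sq_le α
  have h2 := h1.sqrt
  simpa [Real.sqrt_sq (norm_nonneg _)] using h2

theorem H.norm_apply_le {q : ℤ} (F : H w q) (α : Finset ℕ+) : ‖F.1 α‖ ≤ ‖F‖ * w.c α ^ (-q) := by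
  have hc := w.c_pos α
  have h : ‖((w.c α ^ q : ℝ) : ℂ) * F.1 α‖ ≤ ‖F‖ :=
    lp.norm_apply_le_norm (by norm_num) (H.toL2 w q F) α
  rw [norm_mul, Complex.norm_real, Real.norm_of_nonneg (zpow_pos hc _).le] at h
  rw [zpow_neg, ← div_eq_mul_inv, le_div_iff₀ (zpow_pos hc _), mul_comm]
  exact h

theorem S1.norm_apply_le (g : S1 w) (q : ℕ) (α : Finset ℕ+) :
    ‖g.1 α‖ ≤ ‖S1.toH (q : ℤ) g‖ * (w.c α ^ q)⁻¹ := by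
  have h := H.norm_apply_le (S1.toH (q : ℤ) g) α
  rwa [zpow_neg, zpow_natCast] at h

/-- The free index `q` allows the constant to be the same norm of `g` that controls the adjoint part
of `T_f g`. -/
theorem S1.hasGrowth (g : S1 w) (q : ℕ) : HasGrowth w ‖S1.toH (q : ℤ) g‖ 0 g.1 := fun α => by
  refine (S1.norm_apply_le g q α).trans (mul_le_mul_of_nonneg_left ?_ (norm_nonneg _))
  rw [pow_zero]
  exact inv_le_one_of_one_le₀ (one_le_pow₀ (w.one_le_c α))

/-! ### The topologies of `S_1` and `S_{-1}` -/

instance (w : Weight) : IsTopologicalAddGroup (S1 w) :=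
  topologicalAddGroup_iInf fun p => topologicalAddGroup_induced (S1.toH (w := w) p)

instance (w : Weight) : ContinuousSMul ℂ (S1 w) :=
  continuousSMul_iInf fun p => continuousSMul_induced (S1.toH (w := w) p)

/-- The inclusion of `S_1` in `H_p` as a continuous linear map. -/
def S1.toHL (w : Weight) (p : ℤ) : S1 w →L[ℂ] H w p :=
  ⟨S1.toH p, continuous_iInf_dom (i := p) continuous_induced_dom⟩

theorem S1.tendsto_of_forall {ι : Type*} {l : Filter ι} {u : ι → S1 w} {g : S1 w}
    (h : ∀ p : ℤ, Tendsto (fun i => S1.toH p (u i)) l (𝓝 (S1.toH p g))) : Tendsto u l (𝓝 g) := by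
  rw [nhds_iInf, tendsto_iInf]
  intro p
  rw [nhds_induced, tendsto_comap_iff]
  exact h p

/-- The pairing of `H_{-p}` and `H_p`. -/
def pairingH (w : Weight) (p : ℤ) : H w (-p) →L[ℂ] H w p →L[ℂ] ℂ :=
  LinearMap.mkContinuous₂
    (LinearMap.mk₂ ℂ (fun (f : H w (-p)) (g : H w p) => ∑' α, f.1 α * g.1 α)
      (fun f f' g => by
        rw [← (pairing_bound w p f g).1.tsum_add (pairing_bound w p f' g).1]
        exact tsum_congr fun α => add_mul _ _ _)
      (fun r f g => by
        rw [smul_eq_mul, ← tsum_mul_left]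
        exact tsum_congr fun α => mul_assoc _ _ _)
      (fun f g g' => by
        rw [← (pairing_bound w p f g).1.tsum_add (pairing_bound w p f g').1]
        exact tsum_congr fun α => mul_add _ _ _)
      (fun r f g => by
        rw [smul_eq_mul, ← tsum_mul_left]
        exact tsum_congr fun α => mul_left_comm _ _ _)) 1
    fun f g => by simpa using (pairing_bound w p f g).2

/-- The inclusion of `H_{-p}` in `S_{-1}` as a continuous linear map. -/
def H.toSm1L (w : Weight) (p : ℤ) : H w (-p) →L[ℂ] Sm1 w where
  toFun := H.toSm1
  map_add' _ _ := rfl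
  map_smul' _ _ := rfl
  cont := by
    refine continuous_induced_rng.2 ?_
    -- The embedding factors through the dual of `H_p`, followed by restriction of functionals along
    -- `S_1 → H_p`.
    exact (((S1.toHL w p).precomp ℂ).comp (pairingH w p)).continuous

theorem weighted_monomial (w : Weight) (p : ℤ) (α : Finset ℕ+) :
    weighted w p (monomial α) =
      (lp.single (E := fun _ : Finset ℕ+ => ℂ) 2 α ((w.c α ^ p : ℝ) : ℂ) :
        PreLp (fun _ : Finset ℕ+ => ℂ)) := by
  funext β
  show ((w.c β ^ p : ℝ) : ℂ) * (if β = α then 1 else 0) = _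
  by_cases h : β = α
  · subst h; simp
  · simp [h]

theorem monomial_mem (w : Weight) (α : Finset ℕ+) : monomial α ∈ S1 w := by
  rw [S1, Submodule.mem_iInf]
  intro p
  show Memℓp (weighted w p (monomial α)) 2
  rw [weighted_monomial]
  exact lp.memℓp _

theorem norm_toH_monomial (w : Weight) (p : ℤ) (α : Finset ℕ+) :
    ‖S1.toH p (⟨monomial α, monomial_mem w α⟩ : S1 w)‖ = w.c α ^ p := by
  have h : H.toL2 w p (S1.toH p (⟨monomial α, monomial_mem w α⟩ : S1 w)) =
      lp.single 2 α ((w.c α ^ p : ℝ) : ℂ) := Subtype.ext (weighted_monomial w p α)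
  show ‖H.toL2 w p (S1.toH p (⟨monomial α, monomial_mem w α⟩ : S1 w))‖ = _
  rw [h, lp.norm_single (by norm_num), Complex.norm_real,
    Real.norm_of_nonneg (zpow_pos (w.c_pos α) p).le]

theorem pairing_monomial (w : Weight) (f : Sm1 w) (α : Finset ℕ+) :
    pairing w f ⟨monomial α, monomial_mem w α⟩ = f.1 α := by
  show ∑' β, f.1 β * (if β = α then 1 else 0) = _
  rw [tsum_eq_single α fun β hβ => by rw [if_neg hβ, mul_zero], if_pos rfl, mul_one]

theorem Sm1.continuous_apply (w : Weight) (g : S1 w) : Continuous fun f : Sm1 w => pairing w f g :=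
  (continuous_eval_const g).comp continuous_induced_dom

theorem Sm1.continuous_coeff (w : Weight) (α : Finset ℕ+) : Continuous fun f : Sm1 w => f.1 α := by
  simpa only [pairing_monomial] using Sm1.continuous_apply w ⟨monomial α, monomial_mem w α⟩

/-- A function that is continuous on a compact set for the strong topology is bounded on the bounded
subsets of `S_1`. -/
theorem Sm1.exists_bound_of_isCompact {K : Set ℝ} (hK : IsCompact K) {Y : ℝ → Sm1 w}
    (hY : ContinuousOn Y K) {B : Set (S1 w)} (hB : Bornology.IsVonNBounded ℂ B) :
    ∃ C : ℝ, ∀ t ∈ K, ∀ g ∈ B, ‖pairing w (Y t) g‖ ≤ C := by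
  refine hK.induction_on (p := fun s => ∃ C : ℝ, ∀ t ∈ s, ∀ g ∈ B, ‖pairing w (Y t) g‖ ≤ C)
    ⟨0, by simp⟩ (fun s s' hs ⟨C, hC⟩ => ⟨C, fun t ht => hC t (hs ht)⟩) ?_ ?_
  · rintro s s' ⟨C, hC⟩ ⟨C', hC'⟩
    refine ⟨max C C', ?_⟩
    rintro t (ht | ht) g hg
    · exact (hC t ht g hg).trans (le_max_left _ _)
    · exact (hC' t ht g hg).trans (le_max_right _ _)
  · intro t ht
    have h1 : Tendsto (fun s => pairing w (Y s)) (𝓝[K] t) (𝓝 (pairing w (Y t))) :=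
      (continuous_induced_dom.tendsto (Y t)).comp (hY t ht)
    have h2 := (UniformConvergenceCLM.tendsto_iff_tendstoUniformlyOn (σ := RingHom.id ℂ) (F := ℂ)
      {S : Set (S1 w) | Bornology.IsVonNBounded ℂ S}).1 h1 B hB
    rw [Metric.tendstoUniformlyOn_iff] at h2
    obtain ⟨C, hC⟩ :=
      ((NormedSpace.isVonNBounded_iff ℂ).1 (hB.image (pairing w (Y t)))).exists_norm_le
    refine ⟨{s | ∀ g ∈ B, dist (pairing w (Y t) g) (pairing w (Y s) g) < 1}, h2 1 one_pos,
      C + 1, fun s hs g hg => ?_⟩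
    have h3 := hs g hg
    rw [dist_comm, dist_eq_norm] at h3
    have h4 := hC _ (Set.mem_image_of_mem _ hg)
    have h5 := norm_le_norm_add_norm_sub' (pairing w (Y s) g) (pairing w (Y t) g)
    linarith

/-- A function that is continuous on a compact set for the strong topology has values of uniformly
bounded growth. -/
theorem Sm1.exists_growth_of_isCompact {K : Set ℝ} (hK : IsCompact K) {Y : ℝ → Sm1 w}
    (hY : ContinuousOn Y K) : ∃ M p, ∀ t ∈ K, HasGrowth w M p (Y t).1 := by
  by_contra! hcon
  -- Of the two factors `p + 1`, one makes the normalized monomials `g p` tend to `0` in `S_1`,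
  -- hence form a bounded set; the other makes the pairings of `Y` with them exceed every bound.
  have h1 : ∀ p : ℕ, ∃ t ∈ K, ∃ α, ((p : ℝ) + 1) ^ 2 * w.c α ^ p < ‖(Y t).1 α‖ := by
    intro p
    obtain ⟨t, ht, h⟩ := hcon (((p : ℝ) + 1) ^ 2) p
    simp only [HasGrowth, not_forall, not_le] at h
    exact ⟨t, ht, h⟩
  choose t ht α hα using h1
  let g : ℕ → S1 w := fun p =>
    ((((p : ℝ) + 1) * w.c (α p) ^ p)⁻¹ : ℂ) • ⟨monomial (α p), monomial_mem w (α p)⟩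
  have hg : Tendsto g atTop (𝓝 0) := by
    refine S1.tendsto_of_forall fun q => ?_
    rw [map_zero, tendsto_zero_iff_norm_tendsto_zero]
    refine squeeze_zero' (Eventually.of_forall fun p => norm_nonneg _) ?_
      tendsto_one_div_add_atTop_nhds_zero_nat
    filter_upwards [eventually_ge_atTop q.toNat] with p hp
    have hc := w.c_pos (α p)
    rw [map_smul, norm_smul, norm_toH_monomial, norm_inv]
    have e : ‖(((p : ℝ) + 1) * w.c (α p) ^ p : ℂ)‖ = ((p : ℝ) + 1) * w.c (α p) ^ p := by
      rw [← Complex.ofReal_one, ← Complex.ofReal_add, ← Complex.ofReal_pow, ← Complex.ofReal_mul,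
        Complex.norm_real, Real.norm_of_nonneg (by positivity)]
    rw [e, mul_inv, one_div, mul_assoc]
    refine mul_le_of_le_one_right (by positivity) ?_
    rw [inv_mul_le_iff₀ (by positivity), mul_one, ← zpow_natCast]
    exact zpow_le_zpow_right₀ (w.one_le_c _) (by omega)
  obtain ⟨C, hC⟩ := Sm1.exists_bound_of_isCompact hK hY (hg.isVonNBounded_range ℂ)
  obtain ⟨p, hp⟩ := exists_nat_gt C
  have h2 := hC (t p) (ht p) (g p) ⟨p, rfl⟩
  have hc := w.c_pos (α p)
  have e : ‖(((p : ℝ) + 1) * w.c (α p) ^ p : ℂ)‖ = ((p : ℝ) + 1) * w.c (α p) ^ p := by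
    rw [← Complex.ofReal_one, ← Complex.ofReal_add, ← Complex.ofReal_pow, ← Complex.ofReal_mul,
      Complex.norm_real, Real.norm_of_nonneg (by positivity)]
  rw [map_smul, pairing_monomial, norm_smul, norm_inv, e, inv_mul_le_iff₀ (by positivity)] at h2
  have h3 := (hα p).trans_le h2
  have h4 : ((p : ℝ) + 1) * w.c (α p) ^ p * C ≤ ((p : ℝ) + 1) * w.c (α p) ^ p * (p + 1) :=
    mul_le_mul_of_nonneg_left (by linarith) (by positivity)
  nlinarith

instance (w : Weight) (p : ℤ) : CompleteSpace (H w p) := by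
  have h1 : Isometry (H.toL2 w p) := AddMonoidHomClass.isometry_of_norm _ fun _ => rfl
  have h2 : Function.Surjective (H.toL2 w p) := by
    intro x
    have e : weighted w p (fun α => ((w.c α ^ p : ℝ) : ℂ)⁻¹ * x α) = x.1 := by
      funext α
      exact mul_inv_cancel_left₀ (Complex.ofReal_ne_zero.2 (zpow_pos (w.c_pos α) p).ne') _
    refine ⟨⟨fun α => ((w.c α ^ p : ℝ) : ℂ)⁻¹ * x α, ?_⟩, Subtype.ext e⟩
    show Memℓp _ 2
    rw [e]
    exact x.2
  exact (h1.isUniformInducing.completeSpace_congr h2).2 inferInstance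

end Growth

section Product

/-! ### Products and the operators `T_f` -/

theorem mul_apply (f g : Series) (γ : Finset ℕ+) :
    (f * g) γ = ∑ α ∈ γ.powerset, (-1) ^ inversions α (γ \ α) * f α * g (γ \ α) := rfl

theorem Weight.c_le_of_subset (w : Weight) {α β : Finset ℕ+} (h : α ⊆ β) : w.c α ≤ w.c β :=
  Real.exp_le_exp.2 <| Finset.sum_le_sum_of_subset_of_nonneg h fun a _ _ =>
    w.zero ▸ w.mono (Nat.zero_le a)

variable {w : Weight} {M M' : ℝ} {p p' : ℕ} {f f' g : Series}

/-- A coefficient at `γ` has `2^|γ|` terms. Since `c_α ≤ c_γ` for `α ⊆ γ`, spending `2d` powers of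
`c_γ` gives each term a factor `c_α ^ (-2d)`, and these sum to at most `total`. -/
theorem HasGrowth.mul (hf : HasGrowth w M p f) (hg : HasGrowth w M' p' g) :
    HasGrowth w (M * M' * w.total) (p + 2 * w.d + p') (f * g) := by
  intro γ
  have hM := hf.nonneg
  have hM' := hg.nonneg
  rw [mul_apply]
  refine (norm_sum_le _ _).trans ?_
  have h1 : ∀ α ∈ γ.powerset, ‖(-1 : ℂ) ^ inversions α (γ \ α) * f α * g (γ \ α)‖ ≤
      M * M' * w.c γ ^ (p + 2 * w.d + p') * (w.c α ^ (2 * w.d))⁻¹ := by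
    intro α hα
    have hc := w.c_pos α
    have h2 : w.c α ^ p ≤ w.c γ ^ (p + 2 * w.d) * (w.c α ^ (2 * w.d))⁻¹ := by
      rw [← div_eq_mul_inv, le_div_iff₀ (pow_pos hc _), ← pow_add]
      exact pow_le_pow_left₀ hc.le (w.c_le_of_subset (Finset.mem_powerset.1 hα)) _
    have h3 : w.c (γ \ α) ^ p' ≤ w.c γ ^ p' :=
      pow_le_pow_left₀ (w.c_pos _).le (w.c_le_of_subset Finset.sdiff_subset) _
    have h4 : ‖f α‖ ≤ M * (w.c γ ^ (p + 2 * w.d) * (w.c α ^ (2 * w.d))⁻¹) :=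
      (hf α).trans (mul_le_mul_of_nonneg_left h2 hM)
    have h5 : ‖g (γ \ α)‖ ≤ M' * w.c γ ^ p' := (hg _).trans (mul_le_mul_of_nonneg_left h3 hM')
    rw [norm_mul, norm_mul, norm_pow, norm_neg, norm_one, one_pow, one_mul]
    refine (mul_le_mul h4 h5 (norm_nonneg _) ((norm_nonneg _).trans h4)).trans (le_of_eq ?_)
    rw [pow_add _ (p + 2 * w.d) p']
    ring
  refine (Finset.sum_le_sum h1).trans ?_
  rw [← Finset.mul_sum]
  have h6 : ∑ α ∈ γ.powerset, (w.c α ^ (2 * w.d))⁻¹ ≤ w.total :=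
    w.summable_inv_pow.sum_le_tsum _ fun α _ => inv_nonneg.2 (pow_nonneg (w.c_pos α).le _)
  refine (mul_le_mul_of_nonneg_left h6 (mul_nonneg (mul_nonneg hM hM')
    (pow_nonneg (w.c_pos γ).le _))).trans (le_of_eq ?_)
  ring

theorem tendsto_mul_apply {ι : Type*} {l : Filter ι} {F G : ι → Series}
    (hF : ∀ α, Tendsto (fun i => F i α) l (𝓝 (f α)))
    (hG : ∀ α, Tendsto (fun i => G i α) l (𝓝 (g α))) (γ : Finset ℕ+) :
    Tendsto (fun i => (F i * G i) γ) l (𝓝 ((f * g) γ)) :=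
  tendsto_finsetSum _ fun α _ => ((hF α).const_mul _).mul (hG _)

theorem tendsto_mul_const_apply {ι : Type*} {l : Filter ι} {F : ι → Series} (g : Series)
    (hF : ∀ α, Tendsto (fun i => F i α) l (𝓝 (f α))) (γ : Finset ℕ+) :
    Tendsto (fun i => (F i * g) γ) l (𝓝 ((f * g) γ)) := by
  have h : ∀ α, Tendsto (fun _ : ι => g α) l (𝓝 (g α)) := fun α => tendsto_const_nhds
  exact tendsto_mul_apply (G := fun _ => g) hF h γ

theorem hasGrowth_monomial (w : Weight) (γ : Finset ℕ+) :
    HasGrowth w 1 0 (monomial γ) := fun β => by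
  rw [pow_zero, mul_one, monomial]
  split_ifs <;> simp

/-- The product `f i_γ` has growth of order `p + 2d` uniformly in `γ`; decay of `g` to order `p +
4d` leaves a summable `c_β ^ (-2d)`. -/
theorem norm_leftMulAdjoint_term_le (hf : HasGrowth w M p f) (g : S1 w) (γ β : Finset ℕ+) :
    ‖g.1 β * starRingEnd ℂ ((f * monomial γ) β)‖ ≤
      ‖S1.toH ((p + 4 * w.d : ℕ) : ℤ) g‖ * (M * w.total) * (w.c β ^ (2 * w.d))⁻¹ := by
  have h1 := S1.norm_apply_le g (p + 4 * w.d) β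
  have h2 := hf.mul (hasGrowth_monomial w γ) β
  have hc := w.c_pos β
  rw [norm_mul, RCLike.norm_conj]
  refine (mul_le_mul h1 h2 (norm_nonneg _) ((norm_nonneg _).trans h1)).trans (le_of_eq ?_)
  have e : w.c β ^ (p + 4 * w.d) = w.c β ^ (p + 2 * w.d + 0) * w.c β ^ (2 * w.d) := by
    rw [← pow_add]; congr 1; ring
  rw [e, mul_inv]
  field_simp

theorem summable_leftMulAdjoint (hf : HasGrowth w M p f) (g : S1 w) (γ : Finset ℕ+) :
    Summable fun β => g.1 β * starRingEnd ℂ ((f * monomial γ) β) :=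
  Summable.of_norm_bounded (w.summable_inv_pow.mul_left _) fun β =>
    norm_leftMulAdjoint_term_le hf g γ β

theorem HasGrowth.leftMulAdjoint (hf : HasGrowth w M p f) (g : S1 w) :
    HasGrowth w (‖S1.toH ((p + 4 * w.d : ℕ) : ℤ) g‖ * (M * w.total) * w.total) 0
      (leftMulAdjoint f g.1) := by
  intro γ
  rw [pow_zero, mul_one]
  exact tsum_of_norm_bounded (w.summable_inv_pow.hasSum.mul_left _) fun β =>
    norm_leftMulAdjoint_term_le hf g γ β

theorem HasGrowth.opT (hf : HasGrowth w M p f) (g : S1 w) :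
    HasGrowth w ((M * w.total * (1 + w.total)) * ‖S1.toH ((p + 4 * w.d : ℕ) : ℤ) g‖)
      (p + 2 * w.d) (opT f g.1) := by
  intro γ
  have h1 := hf.mul (S1.hasGrowth g (p + 4 * w.d)) γ
  have h2 := (hf.leftMulAdjoint g).mono le_rfl (Nat.zero_le (p + 2 * w.d)) γ
  refine (norm_add_le ((f * g.1) γ) (Grassmann.leftMulAdjoint f g.1 γ)).trans
    ((add_le_add h1 h2).trans (le_of_eq ?_))
  rw [add_zero]
  ring

/-- Coefficients of the product are finite sums, but those of the adjoint are series, so the uniform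
growth is needed for dominated convergence. -/
theorem tendsto_opT_apply {ι : Type*} {l : Filter ι} {F : ι → Series} (g : S1 w)
    (hF : ∀ᶠ i in l, HasGrowth w M p (F i)) (h : ∀ α, Tendsto (fun i => F i α) l (𝓝 (f α)))
    (γ : Finset ℕ+) : Tendsto (fun i => opT (F i) g.1 γ) l (𝓝 (opT f g.1 γ)) := by
  have h1 : Tendsto (fun i => (F i * g.1) γ) l (𝓝 ((f * g.1) γ)) :=
    tendsto_mul_const_apply g.1 h γ
  suffices h2 : Tendsto (fun i => leftMulAdjoint (F i) g.1 γ) l (𝓝 (leftMulAdjoint f g.1 γ)) from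
    h1.add h2
  refine tendsto_tsum_of_dominated_convergence (w.summable_inv_pow.mul_left
    (‖S1.toH ((p + 4 * w.d : ℕ) : ℤ) g‖ * (M * w.total))) (fun β => ?_) ?_
  · exact ((Complex.continuous_conj.tendsto _).comp
      (tendsto_mul_const_apply (monomial γ) h β)).const_mul _
  · filter_upwards [hF] with i hi β
    exact norm_leftMulAdjoint_term_le hi g γ β

theorem opT_add_right (hf : HasGrowth w M p f) (g g' : S1 w) :
    opT f (g + g').1 = opT f g.1 + opT f g'.1 := by
  funext γ
  have h : (f * (g + g').1) γ = (f * g.1) γ + (f * g'.1) γ := by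
    rw [mul_apply, mul_apply, mul_apply, ← Finset.sum_add_distrib]
    exact Finset.sum_congr rfl fun α _ => mul_add _ (g.1 _) (g'.1 _)
  have h' : leftMulAdjoint f (g + g').1 γ = leftMulAdjoint f g.1 γ + leftMulAdjoint f g'.1 γ := by
    unfold leftMulAdjoint
    rw [← (summable_leftMulAdjoint hf g γ).tsum_add (summable_leftMulAdjoint hf g' γ)]
    exact tsum_congr fun β => add_mul (g.1 β) (g'.1 β) _
  show (f * (g + g').1) γ + leftMulAdjoint f (g + g').1 γ =
    ((f * g.1) γ + leftMulAdjoint f g.1 γ) + ((f * g'.1) γ + leftMulAdjoint f g'.1 γ)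
  rw [h, h', add_add_add_comm]

theorem opT_smul_right (f : Series) (r : ℂ) (g : S1 w) : opT f (r • g).1 = r • opT f g.1 := by
  funext γ
  have h : (f * (r • g).1) γ = r * (f * g.1) γ := by
    rw [mul_apply, mul_apply, Finset.mul_sum]
    exact Finset.sum_congr rfl fun α _ => mul_left_comm _ r (g.1 _)
  have h' : leftMulAdjoint f (r • g).1 γ = r * leftMulAdjoint f g.1 γ := by
    unfold leftMulAdjoint
    rw [← tsum_mul_left]
    exact tsum_congr fun β => mul_assoc r (g.1 β) _
  show (f * (r • g).1) γ + leftMulAdjoint f (r • g).1 γ =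
    r * ((f * g.1) γ + leftMulAdjoint f g.1 γ)
  rw [h, h', mul_add]

theorem sub_mul_apply (f f' g : Series) (γ : Finset ℕ+) :
    ((f - f') * g) γ = (f * g) γ - (f' * g) γ := by
  rw [mul_apply, mul_apply, mul_apply, ← Finset.sum_sub_distrib]
  refine Finset.sum_congr rfl fun α _ => ?_
  show _ * (f α - f' α) * _ = _
  ring

theorem smul_mul_apply (r : ℂ) (f g : Series) (γ : Finset ℕ+) :
    ((r • f) * g) γ = r * (f * g) γ := by
  rw [mul_apply, mul_apply, Finset.mul_sum]
  refine Finset.sum_congr rfl fun α _ => ?_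
  show _ * (r * f α) * _ = _
  ring

/-- The scalar is real because `M_f^*` is conjugate-linear in `f`. -/
theorem opT_smul_sub_left (hf : HasGrowth w M p f) (hf' : HasGrowth w M' p' f') (r : ℝ) (g : S1 w) :
    opT ((r : ℂ) • (f - f')) g.1 = (r : ℂ) • (opT f g.1 - opT f' g.1) := by
  funext γ
  show (((r : ℂ) • (f - f')) * g.1) γ + leftMulAdjoint ((r : ℂ) • (f - f')) g.1 γ =
    (r : ℂ) * (((f * g.1) γ + leftMulAdjoint f g.1 γ) - ((f' * g.1) γ + leftMulAdjoint f' g.1 γ))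
  have h : leftMulAdjoint ((r : ℂ) • (f - f')) g.1 γ =
      (r : ℂ) * (leftMulAdjoint f g.1 γ - leftMulAdjoint f' g.1 γ) := by
    simp only [leftMulAdjoint]
    rw [← (summable_leftMulAdjoint hf g γ).tsum_sub (summable_leftMulAdjoint hf' g γ),
      ← tsum_mul_left]
    refine tsum_congr fun β => ?_
    rw [smul_mul_apply, sub_mul_apply, map_mul, map_sub, Complex.conj_ofReal]
    ring
  rw [h, smul_mul_apply, sub_mul_apply]
  ring

/-- The operator `T_f` from `S_1` to the space `H_{-q}` that contains its range. -/
def opTH (hf : HasGrowth w M p f) : S1 w →L[ℂ] H w (-((p + 2 * w.d + w.d : ℕ) : ℤ)) where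
  toFun g := ⟨opT f g.1, (hf.opT g).mem⟩
  map_add' g g' := Subtype.ext (opT_add_right hf g g')
  map_smul' r g := Subtype.ext (opT_smul_right f r g)
  cont := by
    let T : S1 w →ₗ[ℂ] H w (-((p + 2 * w.d + w.d : ℕ) : ℤ)) :=
      { toFun := fun g => ⟨opT f g.1, (hf.opT g).mem⟩
        map_add' := fun g g' => Subtype.ext (opT_add_right hf g g')
        map_smul' := fun r g => Subtype.ext (opT_smul_right f r g) }
    refine continuous_of_continuousAt_zero T ?_
    rw [ContinuousAt, map_zero, tendsto_zero_iff_norm_tendsto_zero]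
    refine squeeze_zero (fun g => norm_nonneg _) (fun g => HasGrowth.norm_le (hf.opT g)) ?_
    have h : Tendsto (fun g : S1 w => ‖S1.toHL w ((p + 4 * w.d : ℕ) : ℤ) g‖) (𝓝 0) (𝓝 0) := by
      have := ((S1.toHL w ((p + 4 * w.d : ℕ) : ℤ)).continuous.norm).tendsto 0
      simpa using this
    have h2 := (h.const_mul (M * w.total * (1 + w.total))).mul_const (√w.total)
    rw [mul_zero, zero_mul] at h2
    exact h2

/-- The operator `T_f` from `S_1` to `S_{-1}`. -/
def opTL (hf : HasGrowth w M p f) : S1 w →L[ℂ] Sm1 w := (H.toSm1L w _).comp (opTH hf)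

/-- Coefficientwise convergence with a uniform bound on the growth implies convergence in the strong
topology. -/
theorem tendsto_Sm1_of_growth {ι : Type*} {l : Filter ι} {F : ι → Sm1 w} {G : Sm1 w}
    (hF : ∀ᶠ i in l, HasGrowth w M p (F i).1) (hG : HasGrowth w M p G.1)
    (h : ∀ α, Tendsto (fun i => (F i).1 α) l (𝓝 (G.1 α))) : Tendsto F l (𝓝 G) := by
  classical
  -- The bound holds only eventually; elsewhere the family is replaced by its limit, so as to live
  -- in one `H_{-q}`.
  let F' : ι → H w (-((p + w.d : ℕ) : ℤ)) := fun i =>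
    if hi : HasGrowth w M p (F i).1 then ⟨(F i).1, hi.mem⟩ else ⟨G.1, hG.mem⟩
  have e : ∀ᶠ i in l, (F' i).1 = (F i).1 := by
    filter_upwards [hF] with i hi
    simp only [F', dif_pos hi]
  have h1 : Tendsto F' l (𝓝 ⟨G.1, hG.mem⟩) := by
    refine tendsto_H_of_growth (M := M) ?_ hG fun α => ?_
    · filter_upwards [hF, e] with i hi he
      rwa [he]
    · refine (h α).congr' ?_
      filter_upwards [e] with i hi
      rw [hi]
  have h2 : Tendsto (fun i => H.toSm1L w _ (F' i)) l (𝓝 G) :=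
    ((H.toSm1L w _).continuous.tendsto ⟨G.1, hG.mem⟩).comp h1
  refine h2.congr' ?_
  filter_upwards [e] with i hi
  exact Subtype.ext hi

end Product

section Noise

/-! ### The noise `W_m` -/

/-- The series `∑ a_n i_n`. -/
def linearSeries (a : ℕ+ → ℂ) : Series := fun α => ∑ n ∈ α, if α = {n} then a n else 0

theorem linearSeries_singleton (a : ℕ+ → ℂ) (n : ℕ+) : linearSeries a {n} = a n := by
  simp [linearSeries]

theorem linearSeries_of_ne (a : ℕ+ → ℂ) {α : Finset ℕ+} (h : ∀ n, α ≠ {n}) :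
    linearSeries a α = 0 :=
  Finset.sum_eq_zero fun n _ => if_neg (h n)

theorem linearSeries_smul_sub (r : ℂ) (a b : ℕ+ → ℂ) :
    r • (linearSeries a - linearSeries b) = linearSeries fun n => r * (a n - b n) := by
  funext α
  show r * (linearSeries a α - linearSeries b α) = _
  by_cases h : ∃ n, α = {n}
  · obtain ⟨n, rfl⟩ := h
    simp only [linearSeries_singleton]
  · push Not at h
    simp only [linearSeries_of_ne _ h, sub_zero, mul_zero]

theorem tendsto_linearSeries {ι : Type*} {l : Filter ι} {A : ι → ℕ+ → ℂ} {a : ℕ+ → ℂ}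
    (h : ∀ n, Tendsto (fun i => A i n) l (𝓝 (a n))) (α : Finset ℕ+) :
    Tendsto (fun i => linearSeries (A i) α) l (𝓝 (linearSeries a α)) := by
  refine tendsto_finsetSum _ fun n _ => ?_
  split_ifs
  exacts [h n, tendsto_const_nhds]

/-- The weights `c_{n}` grow at least as fast as a power of `n`. -/
theorem Weight.natCast_le (w : Weight) (n : ℕ+) : (n : ℝ) ≤ w.total * w.c {n} ^ (2 * w.d) := by
  have hc := w.c_pos {n}
  have hinj : Function.Injective fun k : ℕ+ => ({k} : Finset ℕ+) := Finset.singleton_injective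
  have h1 : ∑ k ∈ Finset.Icc 1 n, (w.c {k} ^ (2 * w.d))⁻¹ ≤ w.total := by
    refine le_of_eq_of_le (Finset.sum_map (Finset.Icc 1 n) ⟨_, hinj⟩ fun α =>
      (w.c α ^ (2 * w.d))⁻¹).symm ?_
    exact w.summable_inv_pow.sum_le_tsum _ fun α _ => inv_nonneg.2 (pow_nonneg (w.c_pos α).le _)
  -- By monotonicity of `φ` the last of the `n` terms is the smallest, so `n` copies of it are at
  -- most `total`.
  have h2 : ∀ k ∈ Finset.Icc 1 n, (w.c {n} ^ (2 * w.d))⁻¹ ≤ (w.c {k} ^ (2 * w.d))⁻¹ := by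
    intro k hk
    refine inv_anti₀ (pow_pos (w.c_pos _) _) (pow_le_pow_left₀ (w.c_pos _).le ?_ _)
    rw [Weight.c, Weight.c, Finset.sum_singleton, Finset.sum_singleton]
    exact Real.exp_le_exp.2 (w.mono (Finset.mem_Icc.1 hk).2)
  have h3 := (Finset.card_nsmul_le_sum _ _ _ h2).trans h1
  rw [nsmul_eq_mul, PNat.card_Icc] at h3
  rw [← div_le_iff₀ (pow_pos hc _), div_eq_mul_inv]
  simpa using h3

theorem hasGrowth_linearSeries (w : Weight) {a : ℕ+ → ℂ} {C : ℝ} (hC : 0 ≤ C)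
    (h : ∀ n, ‖a n‖ ≤ C * (n : ℝ) ^ 4) :
    HasGrowth w (C * w.total ^ 4) (2 * w.d * 4) (linearSeries a) := by
  intro α
  by_cases hα : ∃ n, α = {n}
  · obtain ⟨n, rfl⟩ := hα
    rw [linearSeries_singleton]
    refine (h n).trans ?_
    rw [mul_assoc, pow_mul, ← mul_pow]
    exact mul_le_mul_of_nonneg_left (pow_le_pow_left₀ (by positivity) (w.natCast_le n) 4) hC
  · push Not at hα
    rw [linearSeries_of_ne _ hα, norm_zero]
    exact mul_nonneg (mul_nonneg hC (pow_nonneg w.total_nonneg 4)) (pow_nonneg (w.c_pos α).le _)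

/-- The series `∑ (S_m ξ_n)(t) i_n`. -/
def wm (m : ℝ → ℝ) (t : ℝ) : Series := linearSeries fun n => opS m (hermiteFun n) t

variable {m : ℝ → ℝ}

/-- A single `M` and `p` serve all times and all difference quotients; this uniformity allows the
passage to the derivative. -/
theorem exists_growth_wm (w : Weight) (hm : Measurable m) (hm0 : ∀ u, 0 ≤ m u)
    (hint : Integrable fun u => m u / (u ^ 2 + 1)) :
    ∃ M p, (∀ t, HasGrowth w M p (wm m t)) ∧ (∀ t, HasGrowth w (M * |t|) p (fm m t)) ∧
      ∀ t h : ℝ, HasGrowth w M p (((h : ℂ)⁻¹) • (fm m (t + h) - fm m t)) := by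
  obtain ⟨C, hC, hb⟩ := exists_norm_opS_hermiteFun_le hm hm0 hint
  refine ⟨C * w.total ^ 4, 2 * w.d * 4, fun t => hasGrowth_linearSeries w hC fun n => hb n t,
    fun t => ?_, fun t h => ?_⟩
  · rw [mul_right_comm]
    refine hasGrowth_linearSeries w (mul_nonneg hC (abs_nonneg t)) fun n => ?_
    have := intervalIntegral.norm_integral_le_of_norm_le_const (a := 0) (b := t)
      fun u _ => hb n u
    rwa [sub_zero, mul_right_comm] at this
  · change HasGrowth w _ _ ((h : ℂ)⁻¹ • (linearSeries _ - linearSeries _))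
    rw [linearSeries_smul_sub]
    refine hasGrowth_linearSeries w hC fun n => ?_
    have hi := continuous_opS_hermiteFun hm hm0 hint n
    rw [intervalIntegral.integral_interval_sub_left (hi.intervalIntegrable _ _)
      (hi.intervalIntegrable _ _), norm_mul, norm_inv, Complex.norm_real, Real.norm_eq_abs]
    have := intervalIntegral.norm_integral_le_of_norm_le_const (a := t) (b := t + h)
      fun u _ => hb n u
    rw [add_sub_cancel_left] at this
    -- At `h = 0` the quotient vanishes, by the convention `0⁻¹ = 0`.
    rcases eq_or_ne h 0 with rfl | h0
    · simp; positivity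
    · rw [inv_mul_le_iff₀ (abs_pos.2 h0), mul_comm |h|]
      exact this

theorem tendsto_slope_fm (hm : Measurable m) (hm0 : ∀ u, 0 ≤ m u)
    (hint : Integrable fun u => m u / (u ^ 2 + 1)) (t : ℝ) (α : Finset ℕ+) :
    Tendsto (fun h : ℝ => ((h : ℂ)⁻¹ • (fm m (t + h) - fm m t) : Series) α) (𝓝[≠] 0)
      (𝓝 (wm m t α)) := by
  have e : ∀ h : ℝ, ((h : ℂ)⁻¹ • (fm m (t + h) - fm m t) : Series) α = _ := fun h =>
    congrFun (linearSeries_smul_sub (h : ℂ)⁻¹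
      (fun n => ∫ u in (0 : ℝ)..(t + h), opS m (hermiteFun n) u)
      (fun n => ∫ u in (0 : ℝ)..t, opS m (hermiteFun n) u)) α
  simp only [e]
  refine tendsto_linearSeries (fun n => ?_) α
  have hi := continuous_opS_hermiteFun hm hm0 hint n
  have h1 := hasDerivAt_iff_tendsto_slope_zero.1 (hi.integral_hasStrictDerivAt 0 t).hasDerivAt
  refine h1.congr fun h => ?_
  rw [Complex.real_smul, Complex.ofReal_inv]

theorem continuous_wm (hm : Measurable m) (hm0 : ∀ u, 0 ≤ m u)
    (hint : Integrable fun u => m u / (u ^ 2 + 1)) (α : Finset ℕ+) :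
    Continuous fun t => wm m t α :=
  continuous_iff_continuousAt.2 fun _ => tendsto_linearSeries
    (fun n => (continuous_opS_hermiteFun hm hm0 hint n).continuousAt) α

/-! ### Integrals of continuous functions -/

theorem isLimitOfRiemannSums_of_continuous {E : Type*} [NormedAddCommGroup E] [NormedSpace ℂ E]
    [CompleteSpace E] {F : ℝ → E} (hF : Continuous F) {a b : ℝ} (hab : a ≤ b) :
    IsLimitOfRiemannSums F a b (∫ t in a..b, F t) := by
  intro ε hε
  have hu : UniformContinuousOn F (Set.Icc a b) :=
    isCompact_Icc.uniformContinuousOn_of_continuous hF.continuousOn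
  -- The `+ 1` covers `a = b` and makes the total error `ε (b - a) / (b - a + 1)` strictly less than
  -- `ε`.
  have hε' : 0 < ε / (b - a + 1) := div_pos hε (by linarith)
  obtain ⟨δ, hδ, hd⟩ := Metric.uniformContinuousOn_iff.1 hu _ hε'
  refine ⟨δ, hδ, fun n x τ h0 hn hx => ?_⟩
  have hmono : ∀ i j, i ≤ j → j ≤ n → x i ≤ x j := by
    intro i j hij
    induction j, hij using Nat.le_induction with
    | base => exact fun _ => le_rfl
    | succ j _ ih => exact fun hj => (ih (by omega)).trans (hx j (by omega)).1
  have hint : ∫ t in a..b, F t = ∑ i ∈ Finset.range n, ∫ t in x i..x (i + 1), F t := by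
    rw [intervalIntegral.sum_integral_adjacent_intervals fun k _ => hF.intervalIntegrable _ _,
      h0, hn]
  have hterm : ∀ i ∈ Finset.range n,
      ‖((x (i + 1) - x i : ℝ) : ℂ) • F (τ i) - ∫ t in x i..x (i + 1), F t‖ ≤
        ε / (b - a + 1) * (x (i + 1) - x i) := by
    intro i hi
    have hin := Finset.mem_range.1 hi
    obtain ⟨h1, h2, h3⟩ := hx i hin
    have ha : a ≤ x i := h0 ▸ hmono 0 i (Nat.zero_le _) hin.le
    have hb : x (i + 1) ≤ b := hn ▸ hmono (i + 1) n hin le_rfl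
    have e : ((x (i + 1) - x i : ℝ) : ℂ) • F (τ i) = ∫ _ in x i..x (i + 1), F (τ i) := by
      rw [intervalIntegral.integral_const, Complex.coe_smul]
    rw [e, ← intervalIntegral.integral_sub intervalIntegrable_const (hF.intervalIntegrable _ _)]
    refine (intervalIntegral.norm_integral_le_of_norm_le_const
      (C := ε / (b - a + 1)) fun u hu => ?_).trans ?_
    · rw [Set.uIoc_of_le h1] at hu
      rw [← dist_eq_norm]
      refine (hd _ ⟨ha.trans h3.1, h3.2.trans hb⟩ u ⟨ha.trans hu.1.le, hu.2.trans hb⟩ ?_).le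
      rw [Real.dist_eq, abs_lt]
      constructor <;> linarith [h3.1, h3.2, hu.1, hu.2]
    · rw [abs_of_nonneg (sub_nonneg.2 h1)]
  rw [hint, ← Finset.sum_sub_distrib]
  refine (norm_sum_le _ _).trans_lt ((Finset.sum_le_sum hterm).trans_lt ?_)
  rw [← Finset.mul_sum, Finset.sum_range_sub, h0, hn, div_mul_eq_mul_div,
    div_lt_iff₀ (by linarith)]
  nlinarith

/-- For a functional `L` on `V`, the composite `L ∘ J` is a bounded functional on the Banach space
`E`, so it commutes with the Bochner integral over every measurable subset. -/
theorem hasPettisIntegral_of_continuous {E V : Type*} [NormedAddCommGroup E] [NormedSpace ℂ E]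
    [CompleteSpace E] [AddCommGroup V] [Module ℂ V] [TopologicalSpace V] (J : E →L[ℂ] V)
    {F : ℝ → E} (hF : Continuous F) {a b : ℝ} (hab : a ≤ b) :
    HasPettisIntegral (fun t => J (F t)) a b (J (∫ t in a..b, F t)) := by
  have hi : IntegrableOn F (Set.Icc a b) := hF.continuousOn.integrableOn_compact isCompact_Icc
  refine ⟨fun L => (L.comp J).integrable_comp hi, fun A _ hA => ⟨J (∫ t in A, F t), fun L => ?_⟩,
    fun L => ?_⟩
  · exact ((L.comp J).integral_comp_comm (hi.mono_set hA)).symm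
  · rw [intervalIntegral.integral_of_le hab, ← integral_Icc_eq_integral_Ioc]
    exact ((L.comp J).integral_comp_comm hi).symm

end Noise

end Grassmann

end

/-! ### The derivative process and its integral -/

theorem theorem5p5 (w : Grassmann.Weight) (m : ℝ → ℝ) (hm : Measurable m) (hm0 : ∀ u, 0 ≤ m u)
    (K β : ℝ) (N : ℕ) (hK : 0 < K) (hβ : β < 2)
    (hsmall : ∀ u, 0 < |u| → |u| ≤ 1 → m u ≤ K * |u| ^ (-β))
    (hlarge : ∀ u, 1 < |u| → m u ≤ K * |u| ^ (2 * N))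
    (hint : Integrable fun u => m u / (u ^ 2 + 1)) :
    ∃ W : ℝ → Grassmann.S1 w →L[ℂ] Grassmann.Sm1 w, Grassmann.IsDerivativeProcess w m W ∧
      ∀ (a b : ℝ), a ≤ b → ∀ Y : ℝ → Grassmann.Sm1 w, ContinuousOn Y (Set.Icc a b) →
        ∀ g : Grassmann.S1 w, ∃ p : ℕ, 0 < p ∧
          ∃ F : ℝ → Grassmann.H w (-(p : ℤ)),
            (∀ t ∈ Set.Icc a b,
              (F t : Grassmann.Series) = (Y t : Grassmann.Series) * (W t g : Grassmann.Series)) ∧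
            ∃ I : Grassmann.H w (-(p : ℤ)),
              Grassmann.IsLimitOfRiemannSums F a b I ∧
              Grassmann.HasPettisIntegral (fun t => Grassmann.H.toSm1 (F t)) a b (Grassmann.H.toSm1 I) := by
  open Grassmann in
  obtain ⟨M, p, hw, hf, hq⟩ := exists_growth_wm w hm hm0 hint
  refine ⟨fun t => opTL (hw t), ⟨fun t => opTL (hf t), fun t g => rfl, fun t g => ?_⟩, ?_⟩
  -- The difference quotient of `X_m` is `T` of the difference quotient of `f_m`, so coefficientwise
  -- convergence with uniform growth suffices.
  · have e : ∀ h : ℝ, ((h : ℂ)⁻¹ • (opTL (hf (t + h)) g - opTL (hf t) g) : Sm1 w).1 =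
        opT ((h : ℂ)⁻¹ • (fm m (t + h) - fm m t)) g.1 := fun h => by
      rw [← Complex.ofReal_inv, opT_smul_sub_left (hf (t + h)) (hf t)]
      rfl
    refine tendsto_Sm1_of_growth (Eventually.of_forall fun h => ?_) ((hw t).opT g) fun α => ?_
    · rw [e]
      exact (hq t h).opT g
    · simp only [e]
      exact tendsto_opT_apply g (Eventually.of_forall fun h => hq t h)
        (tendsto_slope_fm hm hm0 hint t) α
  · intro a b hab Y hY g
    obtain ⟨M', p', hY'⟩ := Sm1.exists_growth_of_isCompact isCompact_Icc hY
    -- Extending `Y` by its endpoint values makes the integrand continuous on the whole line.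
    have hYc : Continuous fun t => Y (Set.projIcc a b hab t) :=
      hY.comp_continuous (continuous_subtype_val.comp continuous_projIcc)
        fun t => (Set.projIcc a b hab t).2
    have hF : ∀ t, HasGrowth w _ _ ((Y (Set.projIcc a b hab t)).1 * opT (wm m t) g.1) := fun t =>
      (hY' _ (Set.projIcc a b hab t).2).mul ((hw t).opT g)
    have hFc : Continuous fun t => (⟨_, (hF t).mem⟩ : H w _) :=
      continuous_iff_continuousAt.2 fun t =>
        tendsto_H_of_growth (Eventually.of_forall hF) (hF t) fun α => tendsto_mul_apply
          (fun β => ((Sm1.continuous_coeff w β).comp hYc).continuousAt)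
          (fun β => tendsto_opT_apply g (Eventually.of_forall hw)
            (fun γ => (continuous_wm hm hm0 hint γ).continuousAt) β) α
    -- The exponent is the growth order of the product plus `d`, positive because `d` is.
    refine ⟨_, Nat.add_pos_right _ w.summable.choose_spec.1, fun t => ⟨_, (hF t).mem⟩,
      fun t ht => ?_, ∫ t in a..b, (⟨_, (hF t).mem⟩ : H w _),
      isLimitOfRiemannSums_of_continuous hFc hab,
      hasPettisIntegral_of_continuous (H.toSm1L w _) hFc hab⟩
    show (Y (Set.projIcc a b hab t)).1 * opT (wm m t) g.1 = _
    rw [Set.projIcc_of_mem hab ht]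
    rfl
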